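/- Let $(\varepsilon_i)_{i\in\mathbb Z}$ be independent and identically distributed real random variables with mean $0$ and finite variance which possess a density with respect to Lebesgue measure and whose characteristic function $\psi$ satisfies $\int_{-\infty}^{\infty}|\psi(s)|^{\nu}\,ds<\infty$ for some $1\le\nu<\infty$. Let $(\phi_j)_{j\ge 0}$ be real numbers with $\sum_{j=0}^\infty|\phi_j|<\infty$ and $\sum_{j=0}^\infty\phi_j\neq 0$, and put $w_t=\sum_{j=0}^\infty\phi_j\varepsilon_{t-j}$ for integers $t\ge 1$ (the series converges absolutely almost surely). Let $x_0$ be a real random variable that is independent of the process $(w_t)_{t\ge 1}$, and let $x_t=x_{t-1}+w_t$ for $t\ge 1$. Then, as $n\to\infty$, $$\sum_{t=1}^n|x_t|^{-\alpha}=\begin{cases}O_{\Pr}(n^{\alpha/2}) & \text{if } \alpha>1,\\ O_{\Pr}(n^{1/2}\log n) & \text{if } \alpha=1,\\ O_{\Pr}(n^{1-\alpha/2}) & \text{if } -2\le\alpha<1.\end{cases}$$ Here $Y_n=O_{\Pr}(d_n)$ means that for every $\delta>0$ there is a real $M>0$ such that $\Pr(|Y_n|>Md_n)\le\delta$ for all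 sufficiently large $n$, and $|0|^{-\alpha}$ is read as $+\infty$ when $\alpha>0$. -/

import Mathlib

open MeasureTheory ProbabilityTheory Filter
open scoped ENNReal

/-- The (one-sided) linear process `w_t = ∑_{j ≥ 0} φ_j ε_{t-j}`.  For summable `φ` and identically
distributed integrable `ε_i` the series converges absolutely almost surely. -/
noncomputable def linearProcess {Ω : Type*} (φ : ℕ → ℝ) (ε : ℤ → Ω → ℝ) (t : ℤ) (ω : Ω) : ℝ :=
  ∑' j : ℕ, φ j * ε (t - (j : ℤ)) ω

/-- `Y_n = O_P(d_n)` for nonnegative extended real-valued `Y_n` and real norming constants `d_n`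
(eventually positive): for every `δ > 0` there is a finite `M` such that
`P(Y_n > M d_n) ≤ δ` for all large `n`. -/
def IsBigOInProbability {Ω : Type*} [MeasurableSpace Ω] (μ : Measure Ω)
    (Y : ℕ → Ω → ℝ≥0∞) (d : ℕ → ℝ) : Prop :=
  ∀ δ : ℝ, 0 < δ → ∃ M : ℝ, 0 < M ∧
    ∀ᶠ n : ℕ in atTop, μ {ω | ENNReal.ofReal (M * d n) < Y n ω} ≤ ENNReal.ofReal δ

/-- `∑_{t=1}^n |x_t|^{-α}` as an extended real number, with the convention
`|0|^{-α} = ∞` for `α > 0`. -/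
noncomputable def negPowerSum {Ω : Type*} (x : ℕ → Ω → ℝ) (α : ℝ) (n : ℕ) (ω : Ω) : ℝ≥0∞ :=
  ∑ t ∈ Finset.Icc 1 n, ENNReal.ofReal |x t ω| ^ (-α)

/-!
Let `ψ` be the characteristic function of `ε_0` and `S_t = w_1 + ⋯ + w_t`, so that `x_t = x_0 + S_t`
with `x_0` independent of `S_t`. The proof rests on one estimate, uniform in `r > 0` and in large `t`:
`P(|x_t| ≤ r) ≤ K r / √t` (`exists_measureReal_abs_le_le`).

It is obtained without density or inversion arguments. Integrating the characteristic function of a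
law `m` against the normal law `N(0, r⁻²)` gives `∫ exp (-x² / (2 r²)) dm`, whence
`m [-r, r] ≤ r ∫ g` for every integrable bound `g` of `‖charFun m‖`
(`measureReal_abs_le_le_mul_integral`). The characteristic function of `S_t`, hence that of `x_t`, is
bounded by `∏_{i ∈ I} ‖ψ (c_i s)‖` for each finite set `I` of innovations, where `c_i` is the
coefficient of `ε_i` in `S_t` (`norm_charFun_linearPartialSum_le`). As `∑ φ_j ≠ 0`, at least `t / 2`
of the `c_i` stay away from zero; the arithmetic-geometric mean inequality then bounds the integral
of the product by a multiple of `∫ ‖ψ‖ ^ |I|`, which is `O(|I| ^ (-1/2))`, by the second order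
expansion of `ψ` at `0`, by `sup_{|u| ≥ d} ‖ψ u‖ < 1` and by the integrability of `‖ψ‖ ^ ν`
(`exists_integral_norm_charFun_pow_le`). For the finitely many small `t` it is enough that `x_t ≠ 0`
almost surely (`ae_ne_zero_of_one_le`), as the law of `x_t` has a characteristic function vanishing at
infinity.

For `α > 0` the small-ball bound shows that with probability close to one no `|x_t|`, `t ≤ n`, is
below `a = η / √n`, and a layer-cake computation bounds the mean of `max(|x_t|, a) ^ (-α)` by
`b ^ (-α) + (K α / √t) ∫_a^b u ^ (-α) du` with `b = √n`; summing over `t` and evaluating the integral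
produces the three rates. For `-2 ≤ α ≤ 0` the bound `E S_t² = O(t)` suffices.
-/

open scoped Topology

/-! ### Decay of the characteristic function of the innovations -/

/-- An absolutely continuous law is not a lattice law: `‖charFun m u‖ = 1` would force
`cos (u x - θ) = 1` almost surely, which confines `x` to a countable set. -/
theorem norm_charFun_lt_one {m : Measure ℝ} [IsProbabilityMeasure m] (hm : m ≪ volume)
    {u : ℝ} (hu : u ≠ 0) : ‖charFun m u‖ < 1 := by
  refine lt_of_le_of_ne (norm_charFun_le_one u) fun h => ?_
  set z := charFun m u with hz
  have hint : Integrable (fun x : ℝ => Complex.exp (u * x * Complex.I)) m := by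
    refine Integrable.of_bound (C := 1) (by fun_prop) (ae_of_all _ fun x => ?_)
    rw [← Complex.ofReal_mul, Complex.norm_exp_ofReal_mul_I]
  -- `conj z * z = 1`, so the bounded function `1 - Re (conj z * exp (i u x)) ≥ 0` has mean zero
  have hone : ∫ x : ℝ, (starRingEnd ℂ z * Complex.exp (u * x * Complex.I)).re ∂m = 1 := by
    have h1 := integral_re (𝕜 := ℂ) (hint.const_mul (starRingEnd ℂ z))
    simp only [RCLike.re_eq_complex_re] at h1
    rw [h1, integral_const_mul, ← charFun_apply_real, ← hz, mul_comm, Complex.mul_conj,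
      Complex.normSq_eq_norm_sq, h]
    simp
  have hbd : ∀ x : ℝ, (starRingEnd ℂ z * Complex.exp (u * x * Complex.I)).re ≤ 1 := by
    intro x
    refine (Complex.re_le_norm _).trans ?_
    rw [norm_mul, RCLike.norm_conj, h, ← Complex.ofReal_mul, Complex.norm_exp_ofReal_mul_I]
    norm_num
  have hint2 : Integrable (fun x : ℝ => (starRingEnd ℂ z *
      Complex.exp (u * x * Complex.I)).re) m := (hint.const_mul (starRingEnd ℂ z)).re
  have hzero : ∫ x : ℝ, (1 - (starRingEnd ℂ z * Complex.exp (u * x * Complex.I)).re) ∂m = 0 := by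
    rw [integral_sub (by fun_prop) hint2, hone]; simp
  have hae := (integral_eq_zero_iff_of_nonneg (fun x => sub_nonneg.2 (hbd x))
    ((integrable_const 1).sub hint2)).1 hzero
  have hcount : {x : ℝ | (starRingEnd ℂ z * Complex.exp (u * x * Complex.I)).re = 1}.Countable := by
    refine (Set.countable_range fun k : ℤ => (Complex.arg z + k * (2 * Real.pi)) / u).mono ?_
    intro x hx
    change (starRingEnd ℂ z * Complex.exp (u * x * Complex.I)).re = 1 at hx
    have hz' : z = Complex.exp (Complex.arg z * Complex.I) := by
      conv_lhs => rw [← Complex.norm_mul_exp_arg_mul_I z, h]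
      simp
    have hcos : Real.cos (u * x - Complex.arg z) = 1 := by
      rw [← hx]
      conv_rhs => rw [hz']
      rw [← Complex.exp_conj, ← Complex.exp_add]
      simp only [map_mul, Complex.conj_ofReal, Complex.conj_I]
      rw [show (Complex.arg z : ℂ) * -Complex.I + u * x * Complex.I
        = ((u * x - Complex.arg z : ℝ) : ℂ) * Complex.I by push_cast; ring,
        Complex.exp_ofReal_mul_I_re]
    obtain ⟨k, hk⟩ := (Real.cos_eq_one_iff _).1 hcos
    exact ⟨k, by field_simp; linarith⟩
  have hnull : m {x : ℝ | (starRingEnd ℂ z * Complex.exp (u * x * Complex.I)).re = 1} = 0 :=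
    hm (hcount.measure_zero _)
  have huniv : ∀ᵐ x ∂m, False := by
    filter_upwards [hae, measure_eq_zero_iff_ae_notMem.1 hnull] with x h1 h2
    have h1' : 1 - (starRingEnd ℂ z * Complex.exp (u * x * Complex.I)).re = 0 := h1
    exact h2 (show (starRingEnd ℂ z * Complex.exp (u * x * Complex.I)).re = 1 by linarith)
  have := ae_iff.1 huniv
  simp at this

/-- The Riemann-Lebesgue lemma, applied to the Lebesgue density of `m`. -/
theorem tendsto_charFun_cocompact {m : Measure ℝ} [IsFiniteMeasure m] (hm : m ≪ volume) :
    Tendsto (charFun m) (cocompact ℝ) (𝓝 0) := by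
  have h := Real.tendsto_integral_exp_smul_cocompact
    (fun x : ℝ => ((m.rnDeriv volume x).toReal : ℂ))
  have heq : ∀ s : ℝ, charFun m s = ∫ v : ℝ, Real.fourierChar (-(v * (-(2 * Real.pi)⁻¹ * s))) •
      ((m.rnDeriv volume v).toReal : ℂ) := by
    intro s
    rw [charFun_apply_real]
    conv_lhs => rw [← Measure.withDensity_rnDeriv_eq m volume hm]
    rw [integral_withDensity_eq_integral_toReal_smul (Measure.measurable_rnDeriv _ _)
      (Measure.rnDeriv_lt_top _ _)]
    refine integral_congr_ae (ae_of_all _ fun x => ?_)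
    simp only [Circle.smul_def, Real.fourierChar_apply, smul_eq_mul, Complex.real_smul]
    rw [mul_comm]
    congr 2
    push_cast
    field_simp
  rw [show charFun m = _ from funext heq]
  refine h.comp ?_
  exact (Homeomorph.mulLeft₀ (-(2 * Real.pi)⁻¹) (by simp [Real.pi_ne_zero])).isClosedEmbedding.tendsto_cocompact

/-- Away from the origin the characteristic function is bounded by a constant less than one. -/
theorem exists_norm_charFun_le_of_le_abs {m : Measure ℝ} [IsProbabilityMeasure m]
    (hm : m ≪ volume) {d : ℝ} (hd : 0 < d) :
    ∃ ρ : ℝ, 0 < ρ ∧ ρ < 1 ∧ ∀ u : ℝ, d ≤ |u| → ‖charFun m u‖ ≤ ρ := by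
  have h0 : ∀ᶠ u in cocompact ℝ, ‖charFun m u‖ < 1 / 2 := by
    have := (tendsto_charFun_cocompact hm).norm
    rw [norm_zero] at this
    exact this.eventually (gt_mem_nhds (by norm_num))
  obtain ⟨K, hK, hKs⟩ := mem_cocompact.1 h0
  have hK' : IsCompact (K ∩ {u : ℝ | d ≤ |u|}) :=
    hK.inter_right (isClosed_le continuous_const continuous_abs)
  rcases (K ∩ {u : ℝ | d ≤ |u|}).eq_empty_or_nonempty with he | hne
  · refine ⟨1 / 2, by norm_num, by norm_num, fun u hu => ?_⟩
    by_cases huK : u ∈ K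
    · exact absurd (show u ∈ K ∩ {u : ℝ | d ≤ |u|} from ⟨huK, hu⟩) (by simp [he])
    · exact (hKs huK).le
  · obtain ⟨v, hv, hmax⟩ := hK'.exists_isMaxOn hne
      (f := fun u => ‖charFun m u‖) (continuous_charFun.norm.continuousOn)
    have hv0 : v ≠ 0 := by
      rintro rfl
      have : d ≤ |(0 : ℝ)| := hv.2
      simp at this; linarith
    refine ⟨max (1 / 2) ‖charFun m v‖, by positivity,
      max_lt (by norm_num) (norm_charFun_lt_one hm hv0), fun u hu => ?_⟩
    by_cases huK : u ∈ K
    · exact (hmax ⟨huK, hu⟩).trans (le_max_right _ _)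
    · exact (hKs huK).le.trans (le_max_left _ _)

/-- Second order behaviour at the origin: with mean zero and positive variance, the
characteristic function is dominated by a Gaussian near `0`. -/
theorem exists_norm_charFun_le_exp {m : Measure ℝ} [IsProbabilityMeasure m]
    (h2 : MemLp id 2 m) (hmean : ∫ x, x ∂m = 0) (hvar : 0 < ∫ x, x ^ 2 ∂m) :
    ∃ c d : ℝ, 0 < c ∧ 0 < d ∧ ∀ u : ℝ, |u| < d → ‖charFun m u‖ ≤ Real.exp (-c * u ^ 2) := by
  set V := ∫ x, x ^ 2 ∂m with hV
  have ht : (fun u : ℝ => charFun m u - (1 - V * u ^ 2 / 2 : ℂ)) =o[𝓝 0] fun u : ℝ => u ^ 2 := by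
    have h := taylor_isLittleO_univ (f := charFun m) (x₀ := 0) (n := 2)
      (contDiff_charFun (by exact_mod_cast h2))
    have heq : ∀ u : ℝ, taylorWithinEval (charFun m) 2 Set.univ 0 u = 1 - V * u ^ 2 / 2 := by
      intro u
      rw [taylorWithinEval_charFun_zero (by exact_mod_cast h2)]
      simp [Finset.sum_range_succ, mul_pow, hmean, ← hV]
      ring
    simp only [heq, sub_zero] at h
    exact h
  have h4 := (ht.def (show 0 < V / 4 by positivity))
  obtain ⟨d, hd, hball⟩ := Metric.eventually_nhds_iff.1 h4
  refine ⟨V / 4, min d (Real.sqrt (1 / V)), by positivity, by positivity, fun u hu => ?_⟩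
  have h5 := hball (y := u) (by simpa using hu.trans_le (min_le_left _ _))
  have h6 : V * u ^ 2 ≤ 1 := by
    have : |u| ≤ Real.sqrt (1 / V) := (hu.trans_le (min_le_right _ _)).le
    have h7 := pow_le_pow_left₀ (abs_nonneg u) this 2
    rw [sq_abs, Real.sq_sqrt (by positivity)] at h7
    calc V * u ^ 2 ≤ V * (1 / V) := by gcongr
      _ = 1 := by field_simp
  have h8 : ‖(1 - V * u ^ 2 / 2 : ℂ)‖ = 1 - V * u ^ 2 / 2 := by
    rw [show (1 - V * u ^ 2 / 2 : ℂ) = ((1 - V * u ^ 2 / 2 : ℝ) : ℂ) by push_cast; ring,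
      Complex.norm_real, Real.norm_of_nonneg (by linarith)]
  have h9 : ‖charFun m u‖ ≤ 1 - V * u ^ 2 / 2 + V / 4 * u ^ 2 := by
    calc ‖charFun m u‖ = ‖(1 - V * u ^ 2 / 2 : ℂ) + (charFun m u - (1 - V * u ^ 2 / 2 : ℂ))‖ := by
          congr 1; ring
      _ ≤ _ := (norm_add_le _ _).trans (by
          rw [h8]; gcongr; refine h5.trans (le_of_eq ?_); simp)
  have := Real.add_one_le_exp (-(V / 4) * u ^ 2)
  linarith

theorem exists_geometric_le_div_sqrt {ρ : ℝ} (h0 : 0 < ρ) (h1 : ρ < 1) (N : ℕ) :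
    ∃ B : ℝ, 0 < B ∧ ∀ n : ℕ, N ≤ n → 1 ≤ n → ρ ^ (n - N) ≤ B / Real.sqrt n := by
  have ht := tendsto_pow_const_mul_const_pow_of_abs_lt_one 1 (r := ρ)
    (by rw [abs_of_pos h0]; exact h1)
  obtain ⟨B, hB⟩ := ht.bddAbove_range
  have hB' : ∀ n : ℕ, (n : ℝ) * ρ ^ n ≤ B := fun n => by
    simpa using hB ⟨n, rfl⟩
  refine ⟨(B + 1) / ρ ^ N, ?_, fun n hn hn1 => ?_⟩
  · have := hB' 0
    simp at this
    positivity
  · have hn1' : (1 : ℝ) ≤ n := by exact_mod_cast hn1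
    rw [le_div_iff₀ (by positivity), le_div_iff₀ (by positivity)]
    have hs : Real.sqrt n ≤ n := by
      rw [Real.sqrt_le_left (by positivity)]; nlinarith
    calc ρ ^ (n - N) * Real.sqrt n * ρ ^ N = Real.sqrt n * ρ ^ n := by
          rw [← Nat.sub_add_cancel hn, pow_add]; simp; ring
      _ ≤ n * ρ ^ n := by gcongr
      _ ≤ B + 1 := (hB' n).trans (by linarith)

/-- The integral of the `n`-th power of the characteristic function decays like `n ^ (-1/2)`. -/
theorem exists_integral_norm_charFun_pow_le {m : Measure ℝ} [IsProbabilityMeasure m]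
    (hm : m ≪ volume) (h2 : MemLp id 2 m) (hmean : ∫ x, x ∂m = 0) (hvar : 0 < ∫ x, x ^ 2 ∂m)
    {ν : ℝ} (hν : 0 < ν) (hint : Integrable (fun s : ℝ => ‖charFun m s‖ ^ ν) volume) :
    ∃ C : ℝ, 0 < C ∧ ∃ n₀ : ℕ, ∀ n : ℕ, n₀ ≤ n →
      Integrable (fun s : ℝ => ‖charFun m s‖ ^ n) volume ∧
      ∫ s : ℝ, ‖charFun m s‖ ^ n ≤ C / Real.sqrt n := by
  obtain ⟨c, d, hc, hd, hsmall⟩ := exists_norm_charFun_le_exp h2 hmean hvar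
  obtain ⟨ρ, hρ0, hρ1, hlarge⟩ := exists_norm_charFun_le_of_le_abs hm hd
  obtain ⟨B, hB, hgeo⟩ := exists_geometric_le_div_sqrt hρ0 hρ1 ⌈ν⌉₊
  set J := ∫ s : ℝ, ‖charFun m s‖ ^ ν with hJ
  have hJ0 : 0 ≤ J := integral_nonneg fun s => by positivity
  refine ⟨Real.sqrt (Real.pi / c) + B * J, by positivity, max 1 ⌈ν⌉₊, fun n hn => ?_⟩
  have hn1 : 1 ≤ n := (le_max_left _ _).trans hn
  have hnν : ⌈ν⌉₊ ≤ n := (le_max_right _ _).trans hn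
  have hn0 : (0 : ℝ) < n := by exact_mod_cast hn1
  have hpt : ∀ s : ℝ, ‖charFun m s‖ ^ n ≤
      Real.exp (-(c * n) * s ^ 2) + B / Real.sqrt n * ‖charFun m s‖ ^ ν := by
    intro s
    rcases lt_or_ge |s| d with hs | hs
    · have h1 : ‖charFun m s‖ ^ n ≤ Real.exp (-(c * n) * s ^ 2) := by
        refine (pow_le_pow_left₀ (norm_nonneg _) (hsmall s hs) n).trans (le_of_eq ?_)
        rw [← Real.exp_nat_mul]; congr 1; ring
      have : 0 ≤ B / Real.sqrt n * ‖charFun m s‖ ^ ν := by positivity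
      linarith
    · have h1 : ‖charFun m s‖ ^ n ≤ ρ ^ (n - ⌈ν⌉₊) * ‖charFun m s‖ ^ ν := by
        rw [← Nat.sub_add_cancel hnν, pow_add, Nat.sub_add_cancel hnν]
        have h3 : ‖charFun m s‖ ^ ⌈ν⌉₊ ≤ ‖charFun m s‖ ^ ν := by
          rcases (norm_nonneg (charFun m s)).eq_or_lt with h0 | h0
          · rw [← h0]
            rw [zero_pow (Nat.ceil_pos.2 hν).ne']; positivity
          · rw [← Real.rpow_natCast]
            exact Real.rpow_le_rpow_of_exponent_ge h0 (norm_charFun_le_one s) (Nat.le_ceil ν)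
        gcongr
        exact hlarge s hs
      have h2 := mul_le_mul_of_nonneg_right (hgeo n hnν hn1)
        (show 0 ≤ ‖charFun m s‖ ^ ν by positivity)
      have := Real.exp_pos (-(c * n) * s ^ 2)
      linarith
  have hg : Integrable (fun s : ℝ =>
      Real.exp (-(c * n) * s ^ 2) + B / Real.sqrt n * ‖charFun m s‖ ^ ν) volume :=
    (integrable_exp_neg_mul_sq (by positivity)).add (hint.const_mul _)
  have hi : Integrable (fun s : ℝ => ‖charFun m s‖ ^ n) volume := by
    refine hg.mono' ?_ (ae_of_all _ fun s => ?_)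
    · exact (continuous_charFun.norm.pow n).aestronglyMeasurable
    · rw [Real.norm_of_nonneg (by positivity)]; exact hpt s
  refine ⟨hi, (integral_mono hi hg hpt).trans (le_of_eq ?_)⟩
  rw [integral_add (integrable_exp_neg_mul_sq (by positivity)) (hint.const_mul _),
    integral_gaussian, integral_const_mul, ← hJ, ← div_div, Real.sqrt_div' _ hn0.le]
  ring

/-! ### Small-ball estimates from the characteristic function -/

/-- Smoothing by a Gaussian: the mass of `[-r, r]` is at most a constant times the mean of
`‖charFun m‖` under `N(0, r⁻²)`, because `x ↦ exp (-x² / (2 r²))` dominates `e^{-1/2}` on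
`[-r, r]` and is the characteristic function of that normal law. -/
theorem measureReal_abs_le_le_integral_gaussianReal (m : Measure ℝ) [IsProbabilityMeasure m]
    {r : ℝ} (hr : 0 < r) :
    m.real {x | |x| ≤ r} ≤
      Real.exp (1 / 2) * ∫ s, ‖charFun m s‖ ∂(gaussianReal 0 (Real.toNNReal (1 / r ^ 2))) := by
  set γ := gaussianReal 0 (Real.toNNReal (1 / r ^ 2)) with hγ
  have hfub : ∫ s, charFun m s ∂γ = ∫ x, charFun γ x ∂m := by
    simp only [charFun_apply_real]
    rw [integral_integral_swap]
    · refine integral_congr_ae (ae_of_all _ fun x => integral_congr_ae (ae_of_all _ fun s => ?_))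
      simp only
      rw [mul_comm (s : ℂ)]
    · refine Integrable.of_bound (C := 1) (by fun_prop) (ae_of_all _ fun p => ?_)
      simp only [Function.uncurry]
      rw [← Complex.ofReal_mul, Complex.norm_exp_ofReal_mul_I]
  have hg : ∀ x : ℝ, charFun γ x = (Real.exp (-(x ^ 2 / (2 * r ^ 2))) : ℂ) := by
    intro x
    rw [hγ, charFun_gaussianReal, Complex.ofReal_exp, Real.coe_toNNReal _ (by positivity)]
    congr 1
    push_cast
    field_simp
    ring
  have hreal : ∫ x, charFun γ x ∂m = ((∫ x, Real.exp (-(x ^ 2 / (2 * r ^ 2))) ∂m : ℝ) : ℂ) := by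
    simp only [hg]
    exact integral_ofReal
  have hle : ∫ x, Real.exp (-(x ^ 2 / (2 * r ^ 2))) ∂m ≤ ∫ s, ‖charFun m s‖ ∂γ := by
    have h1 := norm_integral_le_integral_norm (μ := γ) (charFun m)
    rw [hfub, hreal, Complex.norm_real] at h1
    exact (le_abs_self _).trans h1
  have hind : Real.exp (-(1 / 2)) * m.real {x | |x| ≤ r} ≤
      ∫ x, Real.exp (-(x ^ 2 / (2 * r ^ 2))) ∂m := by
    have hms : MeasurableSet {x : ℝ | |x| ≤ r} := measurableSet_le (by fun_prop) (by fun_prop)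
    have hint : Integrable (fun x : ℝ => Real.exp (-(x ^ 2 / (2 * r ^ 2)))) m := by
      refine Integrable.of_bound (C := 1) (by fun_prop) (ae_of_all _ fun x => ?_)
      rw [Real.norm_of_nonneg (Real.exp_pos _).le]
      exact Real.exp_le_one_iff.2 (by simp; positivity)
    calc Real.exp (-(1 / 2)) * m.real {x | |x| ≤ r}
        = ∫ x in {x : ℝ | |x| ≤ r}, Real.exp (-(1 / 2)) ∂m := by
          rw [setIntegral_const, smul_eq_mul, mul_comm]
      _ ≤ ∫ x in {x : ℝ | |x| ≤ r}, Real.exp (-(x ^ 2 / (2 * r ^ 2))) ∂m := by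
          refine setIntegral_mono_on (integrable_const _).integrableOn hint.integrableOn hms fun x hx => ?_
          refine Real.exp_le_exp.2 (neg_le_neg ?_)
          have hx' : |x| ≤ r := hx
          rw [div_le_iff₀ (by positivity)]
          have := pow_le_pow_left₀ (abs_nonneg x) hx' 2
          rw [sq_abs] at this
          linarith
      _ ≤ _ := setIntegral_le_integral hint (ae_of_all _ fun x => (Real.exp_pos _).le)
  calc m.real {x | |x| ≤ r} = Real.exp (1 / 2) * (Real.exp (-(1 / 2)) * m.real {x | |x| ≤ r}) := by
        rw [← mul_assoc, ← Real.exp_add]; simp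
    _ ≤ _ := by gcongr; exact hind.trans hle

/-- If the characteristic function is dominated by an integrable `g`, then
`m [-r, r] ≤ r ∫ g`. -/
theorem measureReal_abs_le_le_mul_integral (m : Measure ℝ) [IsProbabilityMeasure m]
    {g : ℝ → ℝ} (hg : Integrable g volume) (hle : ∀ s, ‖charFun m s‖ ≤ g s)
    {r : ℝ} (hr : 0 < r) :
    m.real {x | |x| ≤ r} ≤ r * ∫ s, g s := by
  refine (measureReal_abs_le_le_integral_gaussianReal m hr).trans ?_
  have hv : Real.toNNReal (1 / r ^ 2) ≠ 0 := by
    simp only [ne_eq, Real.toNNReal_eq_zero, not_le]; positivity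
  have hnn : ∀ s, 0 ≤ g s := fun s => (norm_nonneg _).trans (hle s)
  rw [integral_gaussianReal_eq_integral_smul hv, ← integral_const_mul, ← integral_const_mul]
  refine integral_mono_of_nonneg (ae_of_all _ fun s => ?_) (hg.const_mul r) (ae_of_all _ fun s => ?_)
  · have := gaussianPDFReal_nonneg 0 (Real.toNNReal (1 / r ^ 2)) s
    simp only [Pi.zero_apply, smul_eq_mul]
    positivity
  · simp only [smul_eq_mul]
    -- the normal density with variance `r⁻²` is at most `r / √(2π)`, and `e ≤ 2π`
    have hpdf : Real.exp (1 / 2) * gaussianPDFReal 0 (Real.toNNReal (1 / r ^ 2)) s ≤ r := by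
      rw [gaussianPDFReal_def, Real.coe_toNNReal _ (by positivity)]
      have h1 : Real.exp (-(s - 0) ^ 2 / (2 * (1 / r ^ 2))) ≤ 1 :=
        Real.exp_le_one_iff.2 (div_nonpos_of_nonpos_of_nonneg (by nlinarith [sq_nonneg (s - 0)])
          (by positivity))
      have h2 : Real.exp (1 / 2) ≤ Real.sqrt (2 * Real.pi) := by
        refine Real.le_sqrt_of_sq_le ?_
        rw [← Real.exp_nat_mul]
        have h3 := Real.exp_one_lt_d9
        have h4 := Real.pi_gt_three
        norm_num
        linarith
      have h5 : (Real.sqrt (2 * Real.pi * (1 / r ^ 2)))⁻¹ = r / Real.sqrt (2 * Real.pi) := by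
        rw [Real.sqrt_mul (by positivity), one_div, Real.sqrt_inv, Real.sqrt_sq hr.le]
        field_simp
      rw [h5]
      have h6 : 0 < Real.sqrt (2 * Real.pi) := by positivity
      calc Real.exp (1 / 2) * (r / Real.sqrt (2 * Real.pi) *
            Real.exp (-(s - 0) ^ 2 / (2 * (1 / r ^ 2))))
          ≤ Real.sqrt (2 * Real.pi) * (r / Real.sqrt (2 * Real.pi) * 1) := by gcongr
        _ = r := by field_simp
    rw [← mul_assoc]
    exact mul_le_mul hpdf (hle s) (norm_nonneg _) hr.le

/-- A law whose characteristic function vanishes at infinity has no atom at the origin. -/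
theorem measure_singleton_zero_of_tendsto_charFun (m : Measure ℝ) [IsProbabilityMeasure m]
    (h : Tendsto (charFun m) (cocompact ℝ) (𝓝 0)) : m {0} = 0 := by
  set γ := gaussianReal 0 1 with hγ
  have hbound : ∀ n : ℕ, m.real {0} ≤
      Real.exp (1 / 2) * ∫ s, ‖charFun m (((n : ℝ) + 1) * s)‖ ∂γ := by
    intro n
    have h1 := measureReal_abs_le_le_integral_gaussianReal m (r := 1 / ((n : ℝ) + 1)) (by positivity)
    have h2 : gaussianReal 0 (Real.toNNReal (1 / (1 / ((n : ℝ) + 1)) ^ 2)) =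
        γ.map (((n : ℝ) + 1) * ·) := by
      rw [hγ, gaussianReal_map_const_mul]
      congr 1
      · simp
      · ext
        rw [Real.coe_toNNReal _ (by positivity)]
        simp
    rw [h2, integral_map (by fun_prop) (continuous_charFun.norm.aestronglyMeasurable)] at h1
    refine le_trans (measureReal_mono ?_) h1
    intro x hx
    rw [Set.mem_singleton_iff.1 hx]
    change |(0 : ℝ)| ≤ _
    rw [abs_zero]; positivity
  have hlim : Tendsto (fun n : ℕ => ∫ s, ‖charFun m (((n : ℝ) + 1) * s)‖ ∂γ) atTop
      (𝓝 (∫ _, 0 ∂γ)) := by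
    refine tendsto_integral_of_dominated_convergence (fun _ => 1) ?_ (integrable_const _) ?_ ?_
    · intro n
      exact (continuous_charFun.comp (by fun_prop)).norm.aestronglyMeasurable
    · exact fun n => ae_of_all _ fun s => by
        rw [norm_norm]; exact norm_charFun_le_one _
    · have hne : ∀ᵐ s ∂γ, s ≠ 0 := by
        have hac := gaussianReal_absolutelyContinuous 0 (v := 1) one_ne_zero
        exact hac.ae_le (ae_iff.2 (by simp))
      filter_upwards [hne] with s hs
      have h0 := h.norm
      rw [norm_zero] at h0
      refine h0.comp ?_
      rw [← Metric.cobounded_eq_cocompact, ← tendsto_norm_atTop_iff_cobounded]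
      have : Tendsto (fun n : ℕ => ((n : ℝ) + 1) * |s|) atTop atTop :=
        (tendsto_atTop_add_const_right _ _ tendsto_natCast_atTop_atTop).atTop_mul_const
          (abs_pos.2 hs)
      refine this.congr fun n => ?_
      rw [norm_mul, Real.norm_eq_abs s, Real.norm_of_nonneg (by positivity)]
  have h3 := ge_of_tendsto' (hlim.const_mul (Real.exp (1 / 2))) hbound
  simp only [integral_zero, mul_zero] at h3
  have h4 : m.real {0} = 0 := le_antisymm h3 measureReal_nonneg
  exact (measureReal_eq_zero_iff).1 h4

/-! ### The partial sums of the linear process -/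

/-- The coefficient sequence `φ` extended by zero to the negative integers. -/
noncomputable def zeroExtension (φ : ℕ → ℝ) (k : ℤ) : ℝ := if 0 ≤ k then φ k.toNat else 0

/-- The coefficient of `ε_i` in `w_1 + ⋯ + w_t`. -/
noncomputable def partialSumCoeff (φ : ℕ → ℝ) (t : ℕ) (i : ℤ) : ℝ :=
  ∑ s ∈ Finset.range t, zeroExtension φ ((s : ℤ) + 1 - i)

/-- The partial sum `w_1 + ⋯ + w_t` of the linear process. -/
noncomputable def linearPartialSum {Ω : Type*} (φ : ℕ → ℝ) (ε : ℤ → Ω → ℝ) (t : ℕ) (ω : Ω) : ℝ :=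
  ∑ s ∈ Finset.range t, linearProcess φ ε ((s : ℤ) + 1) ω

@[simp]
theorem zeroExtension_natCast (φ : ℕ → ℝ) (j : ℕ) : zeroExtension φ (j : ℤ) = φ j := by
  simp [zeroExtension]

theorem zeroExtension_of_neg (φ : ℕ → ℝ) {k : ℤ} (hk : k < 0) : zeroExtension φ k = 0 := by
  simp [zeroExtension, not_le.2 hk]

theorem hasSum_abs_zeroExtension {φ : ℕ → ℝ} (hφ : Summable fun j => |φ j|) :
    HasSum (fun k => |zeroExtension φ k|) (∑' j, |φ j|) := by
  refine (Function.Injective.hasSum_iff (g := fun j : ℕ => (j : ℤ)) Nat.cast_injective ?_).1 ?_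
  · intro k hk
    rw [zeroExtension_of_neg, abs_zero]
    by_contra h
    exact hk ⟨k.toNat, by simp; omega⟩
  · simpa [Function.comp_def] using hφ.hasSum

theorem sum_abs_zeroExtension_le {φ : ℕ → ℝ} (hφ : Summable fun j => |φ j|) {ι : Type*}
    (s : Finset ι) {e : ι → ℤ} (he : Function.Injective e) :
    ∑ i ∈ s, |zeroExtension φ (e i)| ≤ ∑' j, |φ j| := by
  have h := sum_le_hasSum (s.map ⟨e, he⟩) (fun k _ => abs_nonneg _) (hasSum_abs_zeroExtension hφ)
  rwa [Finset.sum_map] at h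

theorem abs_partialSumCoeff_le {φ : ℕ → ℝ} (hφ : Summable fun j => |φ j|) (t : ℕ) (i : ℤ) :
    |partialSumCoeff φ t i| ≤ ∑' j, |φ j| :=
  (Finset.abs_sum_le_sum_abs _ _).trans
    (sum_abs_zeroExtension_le hφ _ (e := fun s : ℕ => (s : ℤ) + 1 - i) fun a b h => by
      simp only at h; omega)

theorem sum_partialSumCoeff_sq_le {φ : ℕ → ℝ} (hφ : Summable fun j => |φ j|) (t : ℕ)
    (F : Finset ℤ) :
    ∑ i ∈ F, partialSumCoeff φ t i ^ 2 ≤ (∑' j, |φ j|) ^ 2 * t := by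
  set A := ∑' j, |φ j| with hA
  have hA0 : 0 ≤ A := tsum_nonneg fun j => abs_nonneg _
  calc ∑ i ∈ F, partialSumCoeff φ t i ^ 2
      ≤ ∑ i ∈ F, A * ∑ s ∈ Finset.range t, |zeroExtension φ ((s : ℤ) + 1 - i)| := by
        refine Finset.sum_le_sum fun i _ => ?_
        rw [← sq_abs, sq]
        exact mul_le_mul (abs_partialSumCoeff_le hφ t i) (Finset.abs_sum_le_sum_abs _ _)
          (abs_nonneg _) hA0
    _ = A * ∑ s ∈ Finset.range t, ∑ i ∈ F, |zeroExtension φ ((s : ℤ) + 1 - i)| := by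
        rw [← Finset.mul_sum, Finset.sum_comm]
    _ ≤ A * ∑ _s ∈ Finset.range t, A := by
        gcongr with s _
        exact sum_abs_zeroExtension_le hφ _ (e := fun i : ℤ => (s : ℤ) + 1 - i) fun a b h => by
          simp only at h; omega
    _ = A ^ 2 * t := by simp; ring

/-- For `1 ≤ i ≤ t` the coefficient of `ε_i` is the partial sum `φ_0 + ⋯ + φ_{t-i}`. -/
theorem partialSumCoeff_add_one (φ : ℕ → ℝ) (i n : ℕ) :
    partialSumCoeff φ (i + n) ((i : ℤ) + 1) = ∑ j ∈ Finset.range n, φ j := by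
  rw [partialSumCoeff, Finset.sum_range_add, Finset.sum_eq_zero, zero_add]
  · refine Finset.sum_congr rfl fun j _ => ?_
    rw [← zeroExtension_natCast φ j]
    congr 1
    push_cast
    ring
  · intro s hs
    exact zeroExtension_of_neg _ (by have := Finset.mem_range.1 hs; omega)

/-- If `k` is the first index with `φ k ≠ 0`, then `ε_{t-k}` enters `w_1 + ⋯ + w_t` only
through `w_t`. -/
theorem partialSumCoeff_sub_of_forall_lt {φ : ℕ → ℝ} {k : ℕ} (hk : ∀ j < k, φ j = 0) {t : ℕ}
    (ht : 1 ≤ t) : partialSumCoeff φ t ((t : ℤ) - k) = φ k := by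
  rw [partialSumCoeff, Finset.sum_eq_single (t - 1)]
  · rw [← zeroExtension_natCast φ k]
    congr 1
    omega
  · intro s hs hne
    have hs' := Finset.mem_range.1 hs
    rcases lt_or_ge ((s : ℤ) + 1 - (t - k)) 0 with h | h
    · exact zeroExtension_of_neg _ h
    · obtain ⟨j, hj⟩ := Int.eq_ofNat_of_zero_le h
      rw [hj]
      exact (zeroExtension_natCast φ j).trans (hk j (by omega))
  · intro h
    exact absurd (Finset.mem_range.2 (by omega)) h

/-- Eventually at least half of the coefficients of `w_1 + ⋯ + w_t` exceed `|∑ φ| / 2`. -/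
theorem exists_finset_le_abs_partialSumCoeff {φ : ℕ → ℝ} (hφ : Summable fun j => |φ j|)
    (hsum : ∑' j, φ j ≠ 0) :
    ∃ κ : ℝ, 0 < κ ∧ ∃ t₀ : ℕ, ∀ t, t₀ ≤ t → ∃ I : Finset ℤ,
      t ≤ 2 * I.card ∧ ∀ i ∈ I, κ ≤ |partialSumCoeff φ t i| := by
  have hκ : 0 < |∑' j, φ j| / 2 := by positivity
  have hlim := (hφ.of_abs.hasSum.tendsto_sum_nat).abs
  obtain ⟨J, hJ⟩ := eventually_atTop.1
    (hlim.eventually (lt_mem_nhds (show |∑' j, φ j| / 2 < |∑' j, φ j| by linarith)))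
  refine ⟨_, hκ, 2 * J, fun t ht => ⟨(Finset.range (t - J)).map
    ⟨fun i : ℕ => (i : ℤ) + 1, fun a b h => by simpa using h⟩, ?_, ?_⟩⟩
  · rw [Finset.card_map, Finset.card_range]; omega
  · intro i hi
    obtain ⟨k, hk, rfl⟩ := Finset.mem_map.1 hi
    have hk' := Finset.mem_range.1 hk
    have h := hJ (t - k) (by omega)
    rw [← partialSumCoeff_add_one φ k (t - k), show k + (t - k) = t by omega] at h
    exact h.le

theorem hasSum_linearProcess {Ω : Type*} {φ : ℕ → ℝ} {ε : ℤ → Ω → ℝ} {ω : Ω} {t : ℤ}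
    (h : Summable fun j : ℕ => φ j * ε (t - j) ω) :
    HasSum (fun i : ℤ => zeroExtension φ (t - i) * ε i ω) (linearProcess φ ε t ω) := by
  refine (Function.Injective.hasSum_iff (g := fun j : ℕ => t - (j : ℤ)) ?_ ?_).1 ?_
  · intro a b hab
    simp only at hab
    omega
  · intro i hi
    rw [zeroExtension_of_neg, zero_mul]
    by_contra hneg
    exact hi ⟨(t - i).toNat, by simp only; omega⟩
  · simpa [Function.comp_def, linearProcess] using h.hasSum

theorem hasSum_linearPartialSum {Ω : Type*} {φ : ℕ → ℝ} {ε : ℤ → Ω → ℝ} {ω : Ω}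
    (h : ∀ t : ℤ, Summable fun j : ℕ => φ j * ε (t - j) ω) (t : ℕ) :
    HasSum (fun i : ℤ => partialSumCoeff φ t i * ε i ω) (linearPartialSum φ ε t ω) := by
  simp only [partialSumCoeff, Finset.sum_mul]
  exact hasSum_sum fun s _ => hasSum_linearProcess (h _)

theorem measurable_linearPartialSum {Ω : Type*} [MeasurableSpace Ω] {φ : ℕ → ℝ} {ε : ℤ → Ω → ℝ}
    (hε : ∀ i, Measurable (ε i)) (t : ℕ) : Measurable (linearPartialSum φ ε t) :=
  Finset.measurable_fun_sum _ fun _ _ => Measurable.tsum fun _ => (hε _).const_mul _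

section Innovations

variable {Ω : Type*} [MeasurableSpace Ω] {μ : Measure Ω} {ε : ℤ → Ω → ℝ} {φ : ℕ → ℝ}

theorem ae_summable_linearProcess (hε_meas : ∀ i, Measurable (ε i))
    (hε_ident : ∀ i, IdentDistrib (ε i) (ε 0) μ μ) (hε_int : MemLp (ε 0) 1 μ)
    (hφ : Summable fun j => |φ j|) :
    ∀ᵐ ω ∂μ, ∀ t : ℤ, Summable fun j : ℕ => φ j * ε (t - j) ω := by
  refine ae_all_iff.2 fun t => ?_
  have h := summable_norm_of_tsum_eLpNorm_ne_top (μ := μ) (p := 1) le_rfl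
    (f := fun (j : ℕ) ω => φ j * ε (t - j) ω)
    (fun j => ((hε_meas _).const_mul _).aestronglyMeasurable) ?_
  · filter_upwards [h] with ω hω using hω.of_norm
  · have heq : ∀ j : ℕ, eLpNorm (fun ω => φ j * ε (t - j) ω) 1 μ =
        ENNReal.ofReal |φ j| * eLpNorm (ε 0) 1 μ := by
      intro j
      rw [← (hε_ident (t - j)).eLpNorm_eq 1, ← Real.norm_eq_abs, ofReal_norm]
      exact eLpNorm_const_smul (φ j) (ε (t - j)) 1 μ
    simp only [heq]
    rw [ENNReal.tsum_mul_right]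
    exact ENNReal.mul_ne_top hφ.tsum_ofReal_ne_top hε_int.2.ne

theorem norm_charFun_finsetSum_mul_eq [IsProbabilityMeasure μ] (hε_meas : ∀ i, Measurable (ε i))
    (hε_indep : iIndepFun ε μ) (hε_ident : ∀ i, IdentDistrib (ε i) (ε 0) μ μ)
    (c : ℤ → ℝ) (F : Finset ℤ) (s : ℝ) :
    ‖charFun (μ.map fun ω => ∑ i ∈ F, c i * ε i ω) s‖ =
      ∏ i ∈ F, ‖charFun (μ.map (ε 0)) (c i * s)‖ := by
  have hind : iIndepFun (fun i ω => c i * ε i ω) μ :=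
    hε_indep.comp (fun i x => c i * x) fun i => by fun_prop
  have h := (hind.restrict F).charFun_map_fun_finsetSum_eq_prod
    (fun i _ => ((hε_meas i).const_mul (c i)).aemeasurable)
  rw [h, Finset.prod_apply, norm_prod]
  refine Finset.prod_congr rfl fun i _ => ?_
  rw [charFun_map_mul_comp (hε_meas i).aemeasurable, (hε_ident i).map_eq]

/-- Any finite set of innovations bounds the characteristic function of the partial sum. -/
theorem norm_charFun_linearPartialSum_le [IsProbabilityMeasure μ]
    (hε_meas : ∀ i, Measurable (ε i))
    (hε_indep : iIndepFun ε μ) (hε_ident : ∀ i, IdentDistrib (ε i) (ε 0) μ μ)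
    (hsum : ∀ᵐ ω ∂μ, ∀ t : ℤ, Summable fun j : ℕ => φ j * ε (t - j) ω) (t : ℕ)
    (I : Finset ℤ) (s : ℝ) :
    ‖charFun (μ.map (linearPartialSum φ ε t)) s‖ ≤
      ∏ i ∈ I, ‖charFun (μ.map (ε 0)) (partialSumCoeff φ t i * s)‖ := by
  have : IsProbabilityMeasure (μ.map (ε 0)) :=
    Measure.isProbabilityMeasure_map (hε_meas 0).aemeasurable
  have hmeas : ∀ F : Finset ℤ, Measurable fun ω => ∑ i ∈ F, partialSumCoeff φ t i * ε i ω :=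
    fun F => Finset.measurable_fun_sum _ fun i _ => (hε_meas i).const_mul _
  have hlim : Tendsto (fun F : Finset ℤ =>
      charFun (μ.map fun ω => ∑ i ∈ F, partialSumCoeff φ t i * ε i ω) s) atTop
      (𝓝 (charFun (μ.map (linearPartialSum φ ε t)) s)) := by
    simp only [charFun_apply_real]
    simp_rw [fun F => integral_map (hmeas F).aemeasurable (μ := μ)
      (f := fun x : ℝ => Complex.exp (s * x * Complex.I)) (by fun_prop)]
    rw [integral_map (measurable_linearPartialSum hε_meas t).aemeasurable (by fun_prop)]
    refine tendsto_integral_filter_of_dominated_convergence (fun _ => 1) ?_ ?_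
      (integrable_const _) ?_
    · refine Eventually.of_forall fun F => ?_
      have := hmeas F
      exact Measurable.aestronglyMeasurable (by fun_prop)
    · refine Eventually.of_forall fun F => ae_of_all _ fun ω => ?_
      rw [← Complex.ofReal_mul, Complex.norm_exp_ofReal_mul_I]
    · filter_upwards [hsum] with ω hω
      have h1 : Tendsto (fun F : Finset ℤ => ∑ i ∈ F, partialSumCoeff φ t i * ε i ω) atTop
          (𝓝 (linearPartialSum φ ε t ω)) := hasSum_linearPartialSum hω t
      have hc : Continuous fun x : ℝ => Complex.exp (s * x * Complex.I) := by fun_prop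
      exact (hc.tendsto _).comp h1
  refine le_of_tendsto hlim.norm ?_
  filter_upwards [eventually_ge_atTop I] with F hF
  rw [norm_charFun_finsetSum_mul_eq hε_meas hε_indep hε_ident, ← Finset.prod_sdiff hF]
  exact mul_le_of_le_one_left (Finset.prod_nonneg fun i _ => norm_nonneg _)
    (Finset.prod_le_one (fun i _ => norm_nonneg _) fun i _ => norm_charFun_le_one _)

/-- The variance of `w_1 + ⋯ + w_t` grows at most linearly. -/
theorem lintegral_sq_linearPartialSum_le [IsProbabilityMeasure μ]
    (hε_meas : ∀ i, Measurable (ε i))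
    (hε_indep : iIndepFun ε μ) (hε_ident : ∀ i, IdentDistrib (ε i) (ε 0) μ μ)
    (hε_var : MemLp (ε 0) 2 μ) (hε_mean : ∫ ω, ε 0 ω ∂μ = 0)
    (hφ : Summable fun j => |φ j|)
    (hsum : ∀ᵐ ω ∂μ, ∀ t : ℤ, Summable fun j : ℕ => φ j * ε (t - j) ω) (t : ℕ) :
    ∫⁻ ω, ENNReal.ofReal (linearPartialSum φ ε t ω ^ 2) ∂μ ≤
      ENNReal.ofReal ((∑' j, |φ j|) ^ 2 * variance (ε 0) μ * t) := by
  have hmeas : ∀ F : Finset ℤ, Measurable fun ω => ∑ i ∈ F, partialSumCoeff φ t i * ε i ω :=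
    fun F => Finset.measurable_fun_sum _ fun i _ => (hε_meas i).const_mul _
  have hL2 : ∀ i, MemLp (fun ω => partialSumCoeff φ t i * ε i ω) 2 μ := fun i =>
    ((hε_ident i).memLp_iff.2 hε_var).const_mul _
  have hfin : ∀ F : Finset ℤ,
      ∫⁻ ω, ENNReal.ofReal ((∑ i ∈ F, partialSumCoeff φ t i * ε i ω) ^ 2) ∂μ ≤
        ENNReal.ofReal ((∑' j, |φ j|) ^ 2 * variance (ε 0) μ * t) := by
    intro F
    have hLF : MemLp (fun ω => ∑ i ∈ F, partialSumCoeff φ t i * ε i ω) 2 μ :=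
      memLp_finsetSum _ fun i _ => hL2 i
    rw [← ofReal_integral_eq_lintegral_ofReal hLF.integrable_sq (ae_of_all _ fun ω => sq_nonneg _)]
    refine ENNReal.ofReal_le_ofReal ?_
    have hmean : ∫ ω, ∑ i ∈ F, partialSumCoeff φ t i * ε i ω ∂μ = 0 := by
      rw [integral_finsetSum _ fun i _ => (hL2 i).integrable one_le_two]
      refine Finset.sum_eq_zero fun i _ => ?_
      rw [integral_const_mul, (hε_ident i).integral_eq, hε_mean, mul_zero]
    rw [← variance_of_integral_eq_zero (hmeas F).aemeasurable hmean]
    have hfun : (fun ω => ∑ i ∈ F, partialSumCoeff φ t i * ε i ω) =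
        ∑ i ∈ F, fun ω => partialSumCoeff φ t i * ε i ω := by
      ext ω; simp
    rw [hfun, IndepFun.variance_sum (fun i _ => hL2 i)]
    · simp only [variance_const_mul, fun i => (hε_ident i).variance_eq]
      rw [← Finset.sum_mul]
      have h1 := mul_le_mul_of_nonneg_right (sum_partialSumCoeff_sq_le hφ t F)
        (variance_nonneg (ε 0) μ)
      linarith
    · intro i _ j _ hij
      exact (hε_indep.indepFun hij).comp (φ := fun x => partialSumCoeff φ t i * x)
        (ψ := fun x => partialSumCoeff φ t j * x) (by fun_prop) (by fun_prop)
  calc ∫⁻ ω, ENNReal.ofReal (linearPartialSum φ ε t ω ^ 2) ∂μ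
      ≤ ∫⁻ ω, liminf (fun F : Finset ℤ =>
          ENNReal.ofReal ((∑ i ∈ F, partialSumCoeff φ t i * ε i ω) ^ 2)) atTop ∂μ := by
        refine lintegral_mono_ae ?_
        filter_upwards [hsum] with ω hω
        have h1 : Tendsto (fun F : Finset ℤ => ∑ i ∈ F, partialSumCoeff φ t i * ε i ω) atTop
          (𝓝 (linearPartialSum φ ε t ω)) := hasSum_linearPartialSum hω t
        exact (ENNReal.tendsto_ofReal (h1.pow 2)).liminf_eq.ge
    _ ≤ liminf (fun F : Finset ℤ =>
          ∫⁻ ω, ENNReal.ofReal ((∑ i ∈ F, partialSumCoeff φ t i * ε i ω) ^ 2) ∂μ) atTop :=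
        lintegral_liminf_le' fun F => ((hmeas F).pow_const 2).ennreal_ofReal.aemeasurable
    _ ≤ _ := (liminf_le_liminf (Eventually.of_forall hfin)).trans (by simp)

end Innovations

/-- The arithmetic-geometric mean inequality replaces Hölder's inequality here:
`∏_{i ∈ I} ψ (c_i s) ≤ |I|⁻¹ ∑_{i ∈ I} ψ (c_i s) ^ |I|`, and each summand is integrated by a change
of variables. -/
theorem exists_integrable_prod_comp_mul_le {ψ : ℝ → ℝ} (hψ : ∀ s, 0 ≤ ψ s) {I : Finset ℤ}
    (hI : I.Nonempty) {c : ℤ → ℝ} {κ : ℝ} (hκ : 0 < κ) (hc : ∀ i ∈ I, κ ≤ |c i|)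
    (hint : Integrable (fun s => ψ s ^ I.card) volume) :
    ∃ g : ℝ → ℝ, Integrable g volume ∧ (∀ s, ∏ i ∈ I, ψ (c i * s) ≤ g s) ∧
      ∫ s, g s ≤ κ⁻¹ * ∫ s, ψ s ^ I.card := by
  have hcard : (0 : ℝ) < I.card := by exact_mod_cast hI.card_pos
  have hi : ∀ i ∈ I, Integrable (fun s => (I.card : ℝ)⁻¹ * ψ (c i * s) ^ I.card) volume := by
    intro i hi
    refine Integrable.const_mul (hint.comp_mul_left' ?_) _
    have := hκ.trans_le (hc i hi)
    exact abs_pos.1 this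
  refine ⟨fun s => ∑ i ∈ I, (I.card : ℝ)⁻¹ * ψ (c i * s) ^ I.card, integrable_finsetSum _ hi,
    fun s => ?_, ?_⟩
  · have h := Real.geom_mean_le_arith_mean_weighted I (fun _ => (I.card : ℝ)⁻¹)
      (fun i => ψ (c i * s) ^ I.card) (fun _ _ => by positivity) (by
        rw [Finset.sum_const, nsmul_eq_mul]; field_simp) (fun i _ => pow_nonneg (hψ _) _)
    refine le_trans (le_of_eq (Finset.prod_congr rfl fun i _ => ?_)) h
    rw [Real.pow_rpow_inv_natCast (hψ _) hI.card_pos.ne']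
  · rw [integral_finsetSum _ hi]
    have hJ : 0 ≤ ∫ s, ψ s ^ I.card := integral_nonneg fun s => pow_nonneg (hψ s) _
    calc ∑ i ∈ I, ∫ s, (I.card : ℝ)⁻¹ * ψ (c i * s) ^ I.card
        ≤ ∑ i ∈ I, (I.card : ℝ)⁻¹ * (κ⁻¹ * ∫ s, ψ s ^ I.card) := by
          refine Finset.sum_le_sum fun i hi => ?_
          rw [integral_const_mul, Measure.integral_comp_mul_left (fun s => ψ s ^ I.card), abs_inv,
            smul_eq_mul]
          have := hc i hi
          gcongr
      _ = κ⁻¹ * ∫ s, ψ s ^ I.card := by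
          rw [Finset.sum_const, nsmul_eq_mul]; field_simp

/-! ### The law of the integrated process -/

theorem eq_add_linearPartialSum {Ω : Type*} {ε : ℤ → Ω → ℝ} {φ : ℕ → ℝ} {x : ℕ → Ω → ℝ}
    (hx : ∀ (t : ℕ) (ω : Ω), x (t + 1) ω = x t ω + linearProcess φ ε ((t : ℤ) + 1) ω) (t : ℕ)
    (ω : Ω) : x t ω = x 0 ω + linearPartialSum φ ε t ω := by
  induction t with
  | zero => simp [linearPartialSum]
  | succ t ih => rw [hx, ih, linearPartialSum, linearPartialSum, Finset.sum_range_succ, add_assoc]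

section IntegratedProcess

variable {Ω : Type*} [MeasurableSpace Ω] {μ : Measure Ω} {ε : ℤ → Ω → ℝ} {φ : ℕ → ℝ}
  {x : ℕ → Ω → ℝ}

theorem integral_sq_map_pos [IsProbabilityMeasure μ] {X : Ω → ℝ} (hX : Measurable X)
    (hac : μ.map X ≪ volume) (h2 : MemLp X 2 μ) : 0 < ∫ y, y ^ 2 ∂(μ.map X) := by
  have : IsProbabilityMeasure (μ.map X) := Measure.isProbabilityMeasure_map hX.aemeasurable
  have hnn : ∀ y : ℝ, 0 ≤ y ^ 2 := fun y => sq_nonneg y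
  refine lt_of_le_of_ne (integral_nonneg hnn) fun h => ?_
  have hint : Integrable (fun y : ℝ => y ^ 2) (μ.map X) :=
    (integrable_map_measure (by fun_prop) hX.aemeasurable).2 h2.integrable_sq
  have hae := (integral_eq_zero_iff_of_nonneg hnn hint).1 h.symm
  have hne : ∀ᵐ y ∂(μ.map X), y ≠ 0 := hac.ae_le (ae_iff.2 (by simp))
  have hfalse : ∀ᵐ y ∂(μ.map X), False := by
    filter_upwards [hae, hne] with y h1 h2
    exact h2 (pow_eq_zero_iff two_ne_zero |>.1 h1)
  simpa using ae_iff.1 hfalse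

/-- The independent initial value can only decrease the modulus of the characteristic
function. -/
theorem norm_charFun_le_charFun_linearPartialSum [IsProbabilityMeasure μ]
    (hε_meas : ∀ i, Measurable (ε i)) (hx0_meas : Measurable (x 0))
    (hx0_indep : IndepFun (x 0) (fun ω (t : ℕ) => linearProcess φ ε ((t : ℤ) + 1) ω) μ)
    (hx : ∀ (t : ℕ) (ω : Ω), x (t + 1) ω = x t ω + linearProcess φ ε ((t : ℤ) + 1) ω)
    (t : ℕ) (s : ℝ) :
    ‖charFun (μ.map (x t)) s‖ ≤ ‖charFun (μ.map (linearPartialSum φ ε t)) s‖ := by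
  have : IsProbabilityMeasure (μ.map (x 0)) :=
    Measure.isProbabilityMeasure_map hx0_meas.aemeasurable
  have hind : IndepFun (x 0) (linearPartialSum φ ε t) μ :=
    hx0_indep.comp (φ := id) (ψ := fun w : ℕ → ℝ => ∑ s ∈ Finset.range t, w s)
      measurable_id (by fun_prop)
  have heq : x t = fun ω => x 0 ω + linearPartialSum φ ε t ω :=
    funext fun ω => eq_add_linearPartialSum hx t ω
  rw [heq, hind.charFun_map_fun_add_eq_mul hx0_meas.aemeasurable
    (measurable_linearPartialSum hε_meas t).aemeasurable, Pi.mul_apply, norm_mul]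
  exact mul_le_of_le_one_left (norm_nonneg _) (norm_charFun_le_one _)

/-- The law of `x_t` puts mass at most of order `r / √t` on `[-r, r]`, uniformly in `r`. -/
theorem exists_measureReal_abs_le_le [IsProbabilityMeasure μ]
    {ν : ℝ} (hε_meas : ∀ i, Measurable (ε i)) (hε_indep : iIndepFun ε μ)
    (hε_ident : ∀ i, IdentDistrib (ε i) (ε 0) μ μ)
    (hε_var : MemLp (ε 0) 2 μ) (hε_mean : ∫ ω, ε 0 ω ∂μ = 0)
    (hac : μ.map (ε 0) ≪ volume) (hν : 0 < ν)
    (hε_char : Integrable (fun s : ℝ => ‖charFun (μ.map (ε 0)) s‖ ^ ν) volume)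
    (hφ : Summable (fun j => |φ j|)) (hφ_sum : ∑' j, φ j ≠ 0)
    (hsum : ∀ᵐ ω ∂μ, ∀ t : ℤ, Summable fun j : ℕ => φ j * ε (t - j) ω)
    (hx_meas : ∀ t, Measurable (x t))
    (hxS : ∀ t s, ‖charFun (μ.map (x t)) s‖ ≤ ‖charFun (μ.map (linearPartialSum φ ε t)) s‖) :
    ∃ K : ℝ, 0 < K ∧ ∃ t₀ : ℕ, ∀ t, t₀ ≤ t → ∀ r : ℝ, 0 < r →
      μ.real {ω | |x t ω| ≤ r} ≤ K / Real.sqrt t * r := by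
  have : IsProbabilityMeasure (μ.map (ε 0)) :=
    Measure.isProbabilityMeasure_map (hε_meas 0).aemeasurable
  obtain ⟨C, hC, n₀, hC'⟩ := exists_integral_norm_charFun_pow_le hac
    ((memLp_map_measure_iff (by fun_prop) (hε_meas 0).aemeasurable).2 hε_var)
    (by rw [integral_map (hε_meas 0).aemeasurable (by fun_prop)]; exact hε_mean)
    (integral_sq_map_pos (hε_meas 0) hac hε_var) hν hε_char
  obtain ⟨κ, hκ, t₁, hI⟩ := exists_finset_le_abs_partialSumCoeff hφ hφ_sum
  refine ⟨κ⁻¹ * (2 * C), by positivity, max t₁ (max 1 (2 * n₀)), fun t ht r hr => ?_⟩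
  obtain ⟨I, hcard, hIκ⟩ := hI t ((le_max_left _ _).trans ht)
  have ht1 : 1 ≤ t := (le_max_left _ _).trans ((le_max_right _ _).trans ht)
  have ht2 : 2 * n₀ ≤ t := (le_max_right _ _).trans ((le_max_right _ _).trans ht)
  have hne : I.Nonempty := Finset.card_pos.1 (by omega)
  obtain ⟨hint, hbound⟩ := hC' I.card (by omega)
  obtain ⟨g, hg, hle, hgint⟩ := exists_integrable_prod_comp_mul_le
    (ψ := fun s => ‖charFun (μ.map (ε 0)) s‖) (fun s => norm_nonneg _) hne hκ hIκ hint
  have : IsProbabilityMeasure (μ.map (x t)) :=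
    Measure.isProbabilityMeasure_map (hx_meas t).aemeasurable
  have h1 := measureReal_abs_le_le_mul_integral (μ.map (x t)) hg
    (fun s => (hxS t s).trans ((norm_charFun_linearPartialSum_le hε_meas hε_indep hε_ident hsum t
      I s).trans (hle s))) hr
  rw [map_measureReal_apply (hx_meas t) (measurableSet_le (by fun_prop) (by fun_prop))] at h1
  have ht0 : (0 : ℝ) < t := by exact_mod_cast ht1
  have hI0 : (0 : ℝ) < I.card := by exact_mod_cast hne.card_pos
  have hsqrt : Real.sqrt t ≤ 2 * Real.sqrt I.card := by
    rw [Real.sqrt_le_left (by positivity), mul_pow, Real.sq_sqrt hI0.le]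
    have : (t : ℝ) ≤ 2 * I.card := by exact_mod_cast hcard
    linarith
  have h2 : C / Real.sqrt I.card ≤ 2 * C / Real.sqrt t := by
    rw [div_le_div_iff₀ (by positivity) (by positivity)]
    nlinarith
  calc μ.real {ω | |x t ω| ≤ r} ≤ r * ∫ s, g s := h1
    _ ≤ r * (κ⁻¹ * (2 * C / Real.sqrt t)) := by
        gcongr
        refine hgint.trans ?_
        gcongr
        exact hbound.trans h2
    _ = _ := by ring

/-- At every time `t ≥ 1` the law of `x_t` has no atom at the origin. -/
theorem ae_ne_zero_of_one_le [IsProbabilityMeasure μ]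
    (hε_meas : ∀ i, Measurable (ε i)) (hε_indep : iIndepFun ε μ)
    (hε_ident : ∀ i, IdentDistrib (ε i) (ε 0) μ μ)
    (hac : μ.map (ε 0) ≪ volume) (hφ_sum : ∑' j, φ j ≠ 0)
    (hsum : ∀ᵐ ω ∂μ, ∀ t : ℤ, Summable fun j : ℕ => φ j * ε (t - j) ω)
    (hx_meas : ∀ t, Measurable (x t))
    (hxS : ∀ t s, ‖charFun (μ.map (x t)) s‖ ≤ ‖charFun (μ.map (linearPartialSum φ ε t)) s‖)
    {t : ℕ} (ht : 1 ≤ t) : ∀ᵐ ω ∂μ, x t ω ≠ 0 := by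
  have : IsProbabilityMeasure (μ.map (ε 0)) :=
    Measure.isProbabilityMeasure_map (hε_meas 0).aemeasurable
  have : IsProbabilityMeasure (μ.map (x t)) :=
    Measure.isProbabilityMeasure_map (hx_meas t).aemeasurable
  have hex : ∃ k, φ k ≠ 0 := by
    by_contra! h
    exact hφ_sum (by simp [h])
  classical
  have hk := Nat.find_spec hex
  have hmin : ∀ j < Nat.find hex, φ j = 0 := fun j hj => not_not.1 (Nat.find_min hex hj)
  set k := Nat.find hex
  have hle : ∀ s, ‖charFun (μ.map (x t)) s‖ ≤ ‖charFun (μ.map (ε 0)) (φ k * s)‖ := by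
    intro s
    have h := (hxS t s).trans (norm_charFun_linearPartialSum_le hε_meas hε_indep hε_ident hsum t
      {(t : ℤ) - k} s)
    rwa [Finset.prod_singleton, partialSumCoeff_sub_of_forall_lt hmin ht] at h
  have hlim : Tendsto (charFun (μ.map (x t))) (cocompact ℝ) (𝓝 0) := by
    refine squeeze_zero_norm hle ?_
    have h0 := (tendsto_charFun_cocompact hac).norm
    rw [norm_zero] at h0
    exact h0.comp (Homeomorph.mulLeft₀ (φ k) hk).isClosedEmbedding.tendsto_cocompact
  have h := measure_singleton_zero_of_tendsto_charFun (μ.map (x t)) hlim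
  rw [Measure.map_apply (hx_meas t) (measurableSet_singleton 0)] at h
  exact measure_eq_zero_iff_ae_notMem.1 h

end IntegratedProcess

/-! ### Tools for orders in probability -/

/-- Truncation and Markov: `Y_n = O_P(d_n)` as soon as, off an event of probability `δ`, `Y_n` is
bounded by some `Z` with mean `O(d_n)`; the constant may depend on `δ`. -/
theorem isBigOInProbability_of_lintegral_le {Ω : Type*} [MeasurableSpace Ω] {μ : Measure Ω}
    {Y : ℕ → Ω → ℝ≥0∞} {d : ℕ → ℝ} (hd : ∀ᶠ n in atTop, 0 < d n)
    (h : ∀ δ : ℝ, 0 < δ → ∃ C : ℝ, 0 < C ∧ ∀ᶠ n in atTop, ∃ Z : Ω → ℝ≥0∞, AEMeasurable Z μ ∧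
      μ {ω | Z ω < Y n ω} ≤ ENNReal.ofReal δ ∧ ∫⁻ ω, Z ω ∂μ ≤ ENNReal.ofReal (C * d n)) :
    IsBigOInProbability μ Y d := by
  intro δ hδ
  obtain ⟨C, hC, hev⟩ := h (δ / 2) (by positivity)
  refine ⟨2 * C / δ, by positivity, ?_⟩
  filter_upwards [hev, hd] with n ⟨Z, hZ, hbad, hint⟩ hdn
  have hpos : 0 < 2 * C / δ * d n := by positivity
  have hmarkov : μ {ω | ENNReal.ofReal (2 * C / δ * d n) ≤ Z ω} ≤ ENNReal.ofReal (δ / 2) := by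
    refine (meas_ge_le_lintegral_div hZ (by simpa using hpos) ENNReal.ofReal_ne_top).trans ?_
    refine (ENNReal.div_le_div_right hint _).trans (le_of_eq ?_)
    rw [← ENNReal.ofReal_div_of_pos hpos]
    congr 1
    field_simp
  calc μ {ω | ENNReal.ofReal (2 * C / δ * d n) < Y n ω}
      ≤ μ ({ω | Z ω < Y n ω} ∪ {ω | ENNReal.ofReal (2 * C / δ * d n) ≤ Z ω}) := by
        refine measure_mono fun ω hω => ?_
        rcases lt_or_ge (Z ω) (Y n ω) with h1 | h1
        · exact Or.inl h1
        · exact Or.inr (le_of_lt (lt_of_lt_of_le hω h1))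
    _ ≤ ENNReal.ofReal (δ / 2) + ENNReal.ofReal (δ / 2) :=
        (measure_union_le _ _).trans (add_le_add hbad hmarkov)
    _ = ENNReal.ofReal δ := by
        rw [← ENNReal.ofReal_add (by positivity) (by positivity), add_halves]

/-- An almost surely finite random variable is tight. -/
theorem exists_measure_lt_le {Ω : Type*} [MeasurableSpace Ω] {μ : Measure Ω} [IsFiniteMeasure μ]
    {F : Ω → ℝ≥0∞} (hF : Measurable F) (hfin : ∀ᵐ ω ∂μ, F ω ≠ ∞) {δ : ℝ} (hδ : 0 < δ) :
    ∃ M : ℝ, 0 < M ∧ μ {ω | ENNReal.ofReal M < F ω} ≤ ENNReal.ofReal δ := by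
  have hlim : Tendsto (fun n : ℕ => μ {ω | (n : ℝ≥0∞) < F ω}) atTop (𝓝 0) := by
    have h := tendsto_measure_iInter_atTop (μ := μ) (s := fun n : ℕ => {ω | (n : ℝ≥0∞) < F ω})
      (fun n => (measurableSet_lt measurable_const hF).nullMeasurableSet)
      (fun m n hmn ω (hω : (n : ℝ≥0∞) < F ω) =>
        show (m : ℝ≥0∞) < F ω from lt_of_le_of_lt (by exact_mod_cast hmn) hω)
      ⟨0, measure_ne_top _ _⟩
    have h0 : μ (⋂ n : ℕ, {ω | (n : ℝ≥0∞) < F ω}) = 0 := by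
      refine measure_mono_null (fun ω hω => ?_) (ae_iff.1 hfin)
      simp only [Set.mem_iInter] at hω
      intro hne
      obtain ⟨n, hn⟩ := ENNReal.exists_nat_gt hne
      exact lt_asymm hn (hω n)
    rwa [h0] at h
  have hev := hlim.eventually (gt_mem_nhds (ENNReal.ofReal_pos.2 hδ))
  obtain ⟨n, hn, hn1⟩ := (hev.and (eventually_ge_atTop 1)).exists
  refine ⟨n, by exact_mod_cast hn1, ?_⟩
  rw [ENNReal.ofReal_natCast]
  exact hn.le

theorem integral_mul_rpow_neg_sub_one {α c b : ℝ} (hα : 0 < α) (hc : 0 < c) (hcb : c ≤ b) :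
    ∫ u in c..b, α * u ^ (-α - 1) = c ^ (-α) - b ^ (-α) := by
  rw [intervalIntegral.integral_const_mul, integral_rpow]
  · rw [sub_add_cancel]
    field_simp
    ring
  · refine Or.inr ⟨by linarith, ?_⟩
    rw [Set.uIcc_of_le hcb]
    exact fun h => absurd h.1 (not_le.2 hc)

/-- Layer-cake form of a power truncated to the levels `[a, b]`. -/
theorem ofReal_max_rpow_neg_le {α a b y : ℝ} (hα : 0 < α) (ha : 0 < a) (hab : a ≤ b) :
    ENNReal.ofReal (max y a ^ (-α)) ≤ ENNReal.ofReal (b ^ (-α)) +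
      ∫⁻ u in Set.Ioc a b, (Set.Ici y).indicator (fun u => ENNReal.ofReal (α * u ^ (-α - 1))) u := by
  have hb : 0 < b := ha.trans_le hab
  rcases le_or_gt b (max y a) with h | h
  · refine le_trans (ENNReal.ofReal_le_ofReal ?_) le_self_add
    exact Real.rpow_le_rpow_of_nonpos hb h (by linarith)
  · set c := max y a with hc
    have hac : a ≤ c := le_max_right _ _
    have hc0 : 0 < c := ha.trans_le hac
    have hnn : ∀ u ∈ Set.Ioc c b, 0 ≤ α * u ^ (-α - 1) := fun u hu => by
      have : 0 < u := hc0.trans hu.1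
      positivity
    have hii : IntervalIntegrable (fun u : ℝ => α * u ^ (-α - 1)) volume c b := by
      refine (intervalIntegral.intervalIntegrable_rpow (Or.inr ?_)).const_mul _
      rw [Set.uIcc_of_le h.le]
      exact fun h => absurd h.1 (not_le.2 hc0)
    have hkey : ENNReal.ofReal (c ^ (-α) - b ^ (-α)) =
        ∫⁻ u in Set.Ioc c b, ENNReal.ofReal (α * u ^ (-α - 1)) := by
      rw [← integral_mul_rpow_neg_sub_one hα hc0 h.le, intervalIntegral.integral_of_le h.le,
        ofReal_integral_eq_lintegral_ofReal hii.1
        ((ae_restrict_iff' measurableSet_Ioc).2 (ae_of_all _ hnn))]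
    have hle : ENNReal.ofReal (c ^ (-α)) ≤
        ENNReal.ofReal (b ^ (-α)) + ENNReal.ofReal (c ^ (-α) - b ^ (-α)) := by
      rw [← ENNReal.ofReal_add (by positivity)
        (sub_nonneg.2 (Real.rpow_le_rpow_of_nonpos hc0 h.le (by linarith)))]
      exact ENNReal.ofReal_le_ofReal (by linarith)
    refine hle.trans (add_le_add le_rfl ?_)
    rw [hkey]
    calc ∫⁻ u in Set.Ioc c b, ENNReal.ofReal (α * u ^ (-α - 1))
        = ∫⁻ u in Set.Ioc c b,
            (Set.Ici y).indicator (fun u => ENNReal.ofReal (α * u ^ (-α - 1))) u := by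
          refine setLIntegral_congr_fun measurableSet_Ioc fun u hu => ?_
          rw [Set.indicator_of_mem]
          exact (le_max_left y a).trans hu.1.le
      _ ≤ _ := lintegral_mono_set (Set.Ioc_subset_Ioc_left hac)

/-- A small-ball bound `P(|X| ≤ r) ≤ K r` controls truncated negative moments by the integral of
`u ^ (-α)`. -/
theorem lintegral_max_abs_rpow_neg_le {Ω : Type*} [MeasurableSpace Ω] {μ : Measure Ω}
    [IsProbabilityMeasure μ] {X : Ω → ℝ} (hX : Measurable X) {K : ℝ} (hK : 0 ≤ K)
    (hball : ∀ r, 0 < r → μ.real {ω | |X ω| ≤ r} ≤ K * r) {α a b : ℝ} (hα : 0 < α) (ha : 0 < a)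
    (hab : a ≤ b) :
    ∫⁻ ω, ENNReal.ofReal (max |X ω| a ^ (-α)) ∂μ ≤
      ENNReal.ofReal (b ^ (-α) + K * (α * ∫ u in a..b, u ^ (-α))) := by
  have hb : 0 < b := ha.trans_le hab
  have hii : IntervalIntegrable (fun u : ℝ => u ^ (-α)) volume a b := by
    refine intervalIntegral.intervalIntegrable_rpow (Or.inr ?_)
    rw [Set.uIcc_of_le hab]
    exact fun h => absurd h.1 (not_le.2 ha)
  have hms : MeasurableSet {p : Ω × ℝ | |X p.1| ≤ p.2} :=
    measurableSet_le (by fun_prop) (by fun_prop)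
  have hmeas : Measurable (Function.uncurry fun (ω : Ω) (u : ℝ) =>
      (Set.Ici |X ω|).indicator (fun u => ENNReal.ofReal (α * u ^ (-α - 1))) u) := by
    have : (Function.uncurry fun (ω : Ω) (u : ℝ) =>
        (Set.Ici |X ω|).indicator (fun u => ENNReal.ofReal (α * u ^ (-α - 1))) u) =
        {p : Ω × ℝ | |X p.1| ≤ p.2}.indicator
          (fun p => ENNReal.ofReal (α * p.2 ^ (-α - 1))) := by
      ext ⟨ω, u⟩
      simp [Function.uncurry, Set.indicator]
    rw [this]
    exact Measurable.indicator (by fun_prop) hms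
  calc ∫⁻ ω, ENNReal.ofReal (max |X ω| a ^ (-α)) ∂μ
      ≤ ∫⁻ ω, (ENNReal.ofReal (b ^ (-α)) + ∫⁻ u in Set.Ioc a b,
          (Set.Ici |X ω|).indicator (fun u => ENNReal.ofReal (α * u ^ (-α - 1))) u) ∂μ :=
        lintegral_mono fun ω => ofReal_max_rpow_neg_le hα ha hab
    _ = ENNReal.ofReal (b ^ (-α)) + ∫⁻ u in Set.Ioc a b, ∫⁻ ω,
          (Set.Ici |X ω|).indicator (fun u => ENNReal.ofReal (α * u ^ (-α - 1))) u ∂μ := by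
        rw [lintegral_add_left measurable_const, lintegral_const, measure_univ, mul_one,
          lintegral_lintegral_swap hmeas.aemeasurable]
    _ ≤ ENNReal.ofReal (b ^ (-α)) +
          ∫⁻ u in Set.Ioc a b, ENNReal.ofReal (K * (α * u ^ (-α))) := by
        refine add_le_add le_rfl (setLIntegral_mono (by fun_prop) fun u hu => ?_)
        have hu0 : 0 < u := ha.trans hu.1
        have heq : (fun ω => (Set.Ici |X ω|).indicator
            (fun u => ENNReal.ofReal (α * u ^ (-α - 1))) u) =
            {ω | |X ω| ≤ u}.indicator fun _ => ENNReal.ofReal (α * u ^ (-α - 1)) := by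
          ext ω
          simp [Set.indicator]
        rw [heq, lintegral_indicator_const (measurableSet_le (by fun_prop) (by fun_prop)),
          ← ofReal_measureReal, ← ENNReal.ofReal_mul (by positivity)]
        refine ENNReal.ofReal_le_ofReal ?_
        calc α * u ^ (-α - 1) * μ.real {ω | |X ω| ≤ u} ≤ α * u ^ (-α - 1) * (K * u) := by
              gcongr; exact hball u hu0
          _ = K * (α * u ^ (-α)) := by
              rw [Real.rpow_sub_one hu0.ne']; field_simp
    _ = ENNReal.ofReal (b ^ (-α) + K * (α * ∫ u in a..b, u ^ (-α))) := by
        rw [← intervalIntegral.integral_const_mul, ← intervalIntegral.integral_const_mul,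
          intervalIntegral.integral_of_le hab, ENNReal.ofReal_add (by positivity),
          ofReal_integral_eq_lintegral_ofReal ((hii.1.const_mul α).const_mul K)]
        · refine (ae_restrict_iff' measurableSet_Ioc).2 (ae_of_all _ fun u hu => ?_)
          have hu0 : 0 < u := ha.trans hu.1
          simp only [Pi.zero_apply]
          positivity
        · refine integral_nonneg_of_ae ?_
          refine (ae_restrict_iff' measurableSet_Ioc).2 (ae_of_all _ fun u hu => ?_)
          have hu0 : 0 < u := ha.trans hu.1
          simp only [Pi.zero_apply]
          positivity

theorem sum_Icc_inv_sqrt_le (n : ℕ) :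
    ∑ t ∈ Finset.Icc 1 n, (Real.sqrt t)⁻¹ ≤ 2 * Real.sqrt n := by
  induction n with
  | zero => simp
  | succ n ih =>
    rw [Finset.sum_Icc_succ_top (by omega)]
    have h1 : 0 < Real.sqrt ((n + 1 : ℕ) : ℝ) := Real.sqrt_pos.2 (by positivity)
    have h2 : Real.sqrt ((n + 1 : ℕ) : ℝ) ^ 2 = n + 1 := by
      rw [Real.sq_sqrt (by positivity)]; push_cast; ring
    have h3 : Real.sqrt (n : ℝ) ^ 2 = n := Real.sq_sqrt (by positivity)
    have h4 : (Real.sqrt ((n + 1 : ℕ) : ℝ))⁻¹ ≤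
        2 * (Real.sqrt ((n + 1 : ℕ) : ℝ) - Real.sqrt n) := by
      rw [inv_le_iff_one_le_mul₀ h1]
      nlinarith [sq_nonneg (Real.sqrt ((n + 1 : ℕ) : ℝ) - Real.sqrt n)]
    linarith

/-! ### Sums of powers of a process with small-ball bounds -/

section PowerSums

variable {Ω : Type*} [MeasurableSpace Ω] {μ : Measure Ω} [IsProbabilityMeasure μ]
  {x : ℕ → Ω → ℝ}

/-- Order in probability of the sum of negative powers, from small-ball bounds of order `r / √t`.
The truncation levels are `η / √n`, below which no `|x_t|` with `t ≤ n` falls except with small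
probability, and `√n`. -/
theorem isBigOInProbability_negPowerSum_of_pos (hx_meas : ∀ t, Measurable (x t))
    (hne : ∀ t, 1 ≤ t → ∀ᵐ ω ∂μ, x t ω ≠ 0) {K : ℝ} (hK : 0 < K) {t₀ : ℕ}
    (hball : ∀ t, t₀ ≤ t → ∀ r : ℝ, 0 < r → μ.real {ω | |x t ω| ≤ r} ≤ K / Real.sqrt t * r)
    {α : ℝ} (hα : 0 < α) {d : ℕ → ℝ} (hd0 : ∀ᶠ n in atTop, 0 < d n)
    (hd : ∀ M L η : ℝ, 0 < M → 0 < L → 0 < η → η ≤ 1 → ∃ C : ℝ, 0 < C ∧ ∀ᶠ n : ℕ in atTop,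
      M + (n : ℝ) ^ (1 - α / 2) +
        L * (Real.sqrt n * ∫ u in (η / Real.sqrt n)..(Real.sqrt n), u ^ (-α)) ≤ C * d n) :
    IsBigOInProbability μ (negPowerSum x α) d := by
  refine isBigOInProbability_of_lintegral_le hd0 fun δ hδ => ?_
  set T := max 1 t₀ with hT
  set F : Ω → ℝ≥0∞ := fun ω => ∑ t ∈ Finset.Ico 1 T, ENNReal.ofReal |x t ω| ^ (-α) with hF
  have hF_meas : Measurable F := Finset.measurable_fun_sum _ fun t _ => by
    have := hx_meas t
    fun_prop
  have hF_fin : ∀ᵐ ω ∂μ, F ω ≠ ∞ := by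
    have hall : ∀ᵐ ω ∂μ, ∀ t, 1 ≤ t → x t ω ≠ 0 :=
      ae_all_iff.2 fun t => by
        by_cases ht : 1 ≤ t
        · filter_upwards [hne t ht] with ω hω _ using hω
        · exact ae_of_all _ fun ω h => absurd h ht
    filter_upwards [hall] with ω hω
    refine ENNReal.sum_ne_top.2 fun t ht => ?_
    have hpos : 0 < |x t ω| := abs_pos.2 (hω t (Finset.mem_Ico.1 ht).1)
    rw [ENNReal.ofReal_rpow_of_pos hpos]
    exact ENNReal.ofReal_ne_top
  obtain ⟨M, hM, hFM⟩ := exists_measure_lt_le hF_meas hF_fin (half_pos hδ)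
  set η := min 1 (δ / (4 * K)) with hη
  have hη0 : 0 < η := by positivity
  obtain ⟨C, hC, hev⟩ := hd M (2 * K * α) η hM (by positivity) hη0 (min_le_left _ _)
  refine ⟨C, hC, ?_⟩
  filter_upwards [hev, eventually_ge_atTop 1] with n hn hn1
  have hn0 : (1 : ℝ) ≤ n := by exact_mod_cast hn1
  have hsn : 1 ≤ Real.sqrt n := by rw [Real.one_le_sqrt]; exact hn0
  set a := η / Real.sqrt n with ha
  have ha0 : 0 < a := by positivity
  have hab : a ≤ Real.sqrt n := by
    rw [ha, div_le_iff₀ (by positivity)]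
    have : η ≤ 1 := min_le_left _ _
    nlinarith
  have hsum : ∑ t ∈ Finset.Icc T n, K / Real.sqrt t ≤ 2 * K * Real.sqrt n := by
    calc ∑ t ∈ Finset.Icc T n, K / Real.sqrt t
        ≤ ∑ t ∈ Finset.Icc 1 n, K / Real.sqrt t :=
          Finset.sum_le_sum_of_subset_of_nonneg
            (Finset.Icc_subset_Icc_left (le_max_left _ _)) fun t _ _ => by positivity
      _ = K * ∑ t ∈ Finset.Icc 1 n, (Real.sqrt t)⁻¹ := by
          rw [Finset.mul_sum]; simp only [div_eq_mul_inv]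
      _ ≤ K * (2 * Real.sqrt n) := by gcongr; exact sum_Icc_inv_sqrt_le n
      _ = _ := by ring
  have hballT : ∀ t ∈ Finset.Icc T n, ∀ r : ℝ, 0 < r →
      μ.real {ω | |x t ω| ≤ r} ≤ K / Real.sqrt t * r := fun t ht =>
    hball t ((le_max_right _ _).trans (Finset.mem_Icc.1 ht).1)
  have hterm : ∀ t, Measurable fun ω => ENNReal.ofReal (max |x t ω| a ^ (-α)) := fun t => by
    have := hx_meas t
    fun_prop
  refine ⟨fun ω => ENNReal.ofReal M +
    ∑ t ∈ Finset.Icc T n, ENNReal.ofReal (max |x t ω| a ^ (-α)),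
    (measurable_const.add (Finset.measurable_fun_sum _ fun t _ => hterm t)).aemeasurable, ?_, ?_⟩
  · calc μ {ω | ENNReal.ofReal M + ∑ t ∈ Finset.Icc T n, ENNReal.ofReal (max |x t ω| a ^ (-α)) <
          negPowerSum x α n ω}
        ≤ μ ({ω | ENNReal.ofReal M < F ω} ∪ ⋃ t ∈ Finset.Icc T n, {ω | |x t ω| ≤ a}) := by
          refine measure_mono fun ω hω => ?_
          by_contra hgood
          simp only [Set.mem_union, Set.mem_iUnion, not_or, not_exists] at hgood
          obtain ⟨hg1, hg2⟩ := hgood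
          have hlt : _ < negPowerSum x α n ω := hω
          refine absurd hlt (not_lt.2 ?_)
          have hsplit : negPowerSum x α n ω ≤
              F ω + ∑ t ∈ Finset.Icc T n, ENNReal.ofReal |x t ω| ^ (-α) := by
            have hdisj : Disjoint (Finset.Ico 1 T) (Finset.Icc T n) := by
              rw [Finset.disjoint_left]
              intro t h1 h2
              have := (Finset.mem_Ico.1 h1).2
              have := (Finset.mem_Icc.1 h2).1
              omega
            rw [hF, ← Finset.sum_union hdisj]
            refine Finset.sum_le_sum_of_subset fun t ht => ?_
            have := Finset.mem_Icc.1 ht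
            simp only [Finset.mem_union, Finset.mem_Ico, Finset.mem_Icc]
            omega
          refine hsplit.trans (add_le_add (not_lt.1 hg1) (Finset.sum_le_sum fun t ht => ?_))
          have hxa : a < |x t ω| := not_le.1 (hg2 t ht)
          rw [max_eq_left hxa.le, ENNReal.ofReal_rpow_of_pos (ha0.trans hxa)]
      _ ≤ ENNReal.ofReal (δ / 2) + ∑ t ∈ Finset.Icc T n, μ {ω | |x t ω| ≤ a} :=
          (measure_union_le _ _).trans (add_le_add hFM (measure_biUnion_finset_le _ _))
      _ ≤ ENNReal.ofReal (δ / 2) + ∑ t ∈ Finset.Icc T n, ENNReal.ofReal (K / Real.sqrt t * a) := by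
          refine add_le_add le_rfl (Finset.sum_le_sum fun t ht => ?_)
          rw [← ofReal_measureReal]
          exact ENNReal.ofReal_le_ofReal (hballT t ht a ha0)
      _ = ENNReal.ofReal (δ / 2 + (∑ t ∈ Finset.Icc T n, K / Real.sqrt t) * a) := by
          rw [← ENNReal.ofReal_sum_of_nonneg fun t _ => by positivity, ← Finset.sum_mul,
            ← ENNReal.ofReal_add (by positivity) (by positivity)]
      _ ≤ ENNReal.ofReal δ := by
          refine ENNReal.ofReal_le_ofReal ?_
          have h1 : (∑ t ∈ Finset.Icc T n, K / Real.sqrt t) * a ≤ 2 * K * η := by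
            calc (∑ t ∈ Finset.Icc T n, K / Real.sqrt t) * a ≤ 2 * K * Real.sqrt n * a := by gcongr
              _ = 2 * K * η := by rw [ha]; field_simp
          have h2 : 2 * K * η ≤ δ / 2 := by
            calc 2 * K * η ≤ 2 * K * (δ / (4 * K)) := by gcongr; exact min_le_right _ _
              _ = δ / 2 := by field_simp; norm_num
          linarith
  · have hJ : 0 ≤ ∫ u in a..(Real.sqrt n), u ^ (-α) :=
      intervalIntegral.integral_nonneg hab fun u hu => by
        have : 0 < u := ha0.trans_le hu.1
        positivity
    rw [lintegral_add_left measurable_const, lintegral_const, measure_univ, mul_one,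
      lintegral_finsetSum _ fun t _ => hterm t]
    have hb : (n : ℝ) * Real.sqrt n ^ (-α) = (n : ℝ) ^ (1 - α / 2) := by
      rw [Real.sqrt_eq_rpow, ← Real.rpow_mul (by positivity), sub_eq_add_neg,
        Real.rpow_add (by positivity), Real.rpow_one]
      congr 2
      ring
    calc ENNReal.ofReal M + ∑ t ∈ Finset.Icc T n, ∫⁻ ω, ENNReal.ofReal (max |x t ω| a ^ (-α)) ∂μ
        ≤ ENNReal.ofReal M + ∑ t ∈ Finset.Icc T n, ENNReal.ofReal (Real.sqrt n ^ (-α) +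
            K / Real.sqrt t * (α * ∫ u in a..(Real.sqrt n), u ^ (-α))) := by
          gcongr with t ht
          exact lintegral_max_abs_rpow_neg_le (hx_meas t) (by positivity) (hballT t ht) hα ha0 hab
      _ = ENNReal.ofReal (M + ∑ t ∈ Finset.Icc T n, (Real.sqrt n ^ (-α) +
            K / Real.sqrt t * (α * ∫ u in a..(Real.sqrt n), u ^ (-α)))) := by
          rw [← ENNReal.ofReal_sum_of_nonneg fun t _ => by positivity,
            ← ENNReal.ofReal_add hM.le (Finset.sum_nonneg fun t _ => by positivity)]
      _ ≤ ENNReal.ofReal (C * d n) := by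
          refine ENNReal.ofReal_le_ofReal (le_trans ?_ hn)
          rw [Finset.sum_add_distrib, ← Finset.sum_mul, Finset.sum_const, nsmul_eq_mul,
            Nat.card_Icc, add_assoc]
          refine add_le_add le_rfl (add_le_add ?_ ?_)
          · rw [← hb]
            gcongr
            have : 1 ≤ T := le_max_left _ _
            omega
          · calc (∑ t ∈ Finset.Icc T n, K / Real.sqrt t) * (α * ∫ u in a..(Real.sqrt n), u ^ (-α))
                ≤ 2 * K * Real.sqrt n * (α * ∫ u in a..(Real.sqrt n), u ^ (-α)) := by gcongr
              _ = _ := by ring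

/-- Order in probability of the sum of nonnegative powers of exponent at most two, from a linear
bound on the second moment of `x_t - x_0`, through `y ^ β ≤ n ^ (β / 2) (1 + y² / n)`. -/
theorem isBigOInProbability_negPowerSum_of_nonpos (hx_meas : ∀ t, Measurable (x t)) {V : ℝ}
    (hV : 0 ≤ V)
    (hmom : ∀ t, ∫⁻ ω, ENNReal.ofReal ((x t ω - x 0 ω) ^ 2) ∂μ ≤ ENNReal.ofReal (V * t))
    {α : ℝ} (hα2 : -2 ≤ α) (hα0 : α ≤ 0) :
    IsBigOInProbability μ (negPowerSum x α) (fun n : ℕ => (n : ℝ) ^ (1 - α / 2)) := by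
  have hd0 : ∀ᶠ n : ℕ in atTop, (0 : ℝ) < (n : ℝ) ^ (1 - α / 2) := by
    filter_upwards [eventually_ge_atTop 1] with n hn
    have : (0 : ℝ) < n := by exact_mod_cast hn
    positivity
  refine isBigOInProbability_of_lintegral_le hd0 fun δ hδ => ?_
  have h0 := hx_meas 0
  obtain ⟨M, hM, hbad⟩ := exists_measure_lt_le (μ := μ)
    (F := fun ω => ENNReal.ofReal (x 0 ω ^ 2)) (by fun_prop)
    (ae_of_all _ fun ω => ENNReal.ofReal_ne_top) hδ
  refine ⟨1 + 2 * M + 2 * V, by positivity, ?_⟩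
  filter_upwards [eventually_ge_atTop 1] with n hn1
  have hn1' : (1 : ℝ) ≤ n := by exact_mod_cast hn1
  have hn0 : (0 : ℝ) < n := by linarith
  set A : ℝ := (n : ℝ) ^ (-α / 2) with hA
  have hA0 : 0 < A := by positivity
  have hterm : ∀ t, Measurable fun ω => ENNReal.ofReal (A * (1 + 2 * M)) +
      ENNReal.ofReal (A * (2 / n)) * ENNReal.ofReal ((x t ω - x 0 ω) ^ 2) := fun t => by
    have := hx_meas t
    fun_prop
  refine ⟨fun ω => ∑ t ∈ Finset.Icc 1 n, (ENNReal.ofReal (A * (1 + 2 * M)) +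
      ENNReal.ofReal (A * (2 / n)) * ENNReal.ofReal ((x t ω - x 0 ω) ^ 2)),
    (Finset.measurable_fun_sum _ fun t _ => hterm t).aemeasurable, ?_, ?_⟩
  · refine (measure_mono fun ω hω => ?_).trans hbad
    by_contra hgood
    have hlt : _ < negPowerSum x α n ω := hω
    refine absurd hlt (not_lt.2 (Finset.sum_le_sum fun t _ => ?_))
    have hx0 : x 0 ω ^ 2 ≤ M := by
      have hg : ¬ ENNReal.ofReal M < ENNReal.ofReal (x 0 ω ^ 2) := hgood
      by_contra hlt
      exact hg ((ENNReal.ofReal_lt_ofReal_iff (hM.trans (not_le.1 hlt))).2 (not_le.1 hlt))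
    rw [ENNReal.ofReal_rpow_of_nonneg (abs_nonneg _) (by linarith),
      ← ENNReal.ofReal_mul (by positivity), ← ENNReal.ofReal_add (by positivity) (by positivity)]
    refine ENNReal.ofReal_le_ofReal ?_
    -- with `z = |x_t| / √n`, either `z ≤ 1` or `z ^ β ≤ z ^ 2`
    set z := |x t ω| / Real.sqrt n with hz
    have hz0 : 0 ≤ z := by positivity
    have hxz : |x t ω| ^ (-α) = A * z ^ (-α) := by
      have : |x t ω| = Real.sqrt n * z := by rw [hz]; field_simp
      rw [this, Real.mul_rpow (by positivity) hz0, hA, Real.sqrt_eq_rpow,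
        ← Real.rpow_mul hn0.le]
      congr 2
      ring
    have hz2 : z ^ (-α) ≤ 1 + z ^ 2 := by
      rcases le_total z 1 with h | h
      · have := Real.rpow_le_one hz0 h (show 0 ≤ -α by linarith)
        nlinarith
      · have h3 := Real.rpow_le_rpow_of_exponent_le h (show -α ≤ 2 by linarith)
        rw [Real.rpow_two] at h3
        linarith
    have hzsq : z ^ 2 ≤ 2 * M + 2 / n * (x t ω - x 0 ω) ^ 2 := by
      rw [hz, div_pow, Real.sq_sqrt hn0.le, sq_abs, div_le_iff₀ hn0, add_mul]
      have h4 : 2 / (n : ℝ) * (x t ω - x 0 ω) ^ 2 * n = 2 * (x t ω - x 0 ω) ^ 2 := by field_simp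
      rw [h4]
      nlinarith [sq_nonneg (x t ω - 2 * x 0 ω)]
    rw [hxz]
    nlinarith
  · calc ∫⁻ ω, ∑ t ∈ Finset.Icc 1 n, (ENNReal.ofReal (A * (1 + 2 * M)) +
          ENNReal.ofReal (A * (2 / n)) * ENNReal.ofReal ((x t ω - x 0 ω) ^ 2)) ∂μ
        = ∑ t ∈ Finset.Icc 1 n, (ENNReal.ofReal (A * (1 + 2 * M)) +
          ENNReal.ofReal (A * (2 / n)) * ∫⁻ ω, ENNReal.ofReal ((x t ω - x 0 ω) ^ 2) ∂μ) := by
          rw [lintegral_finsetSum _ fun t _ => hterm t]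
          refine Finset.sum_congr rfl fun t _ => ?_
          rw [lintegral_add_left measurable_const, lintegral_const, measure_univ, mul_one,
            lintegral_const_mul' _ _ ENNReal.ofReal_ne_top]
      _ ≤ ∑ _t ∈ Finset.Icc 1 n, ENNReal.ofReal (A * (1 + 2 * M) + A * (2 * V)) := by
          refine Finset.sum_le_sum fun t ht => ?_
          rw [ENNReal.ofReal_add (by positivity) (by positivity)]
          refine add_le_add le_rfl ((mul_le_mul_right (hmom t) _).trans ?_)
          rw [← ENNReal.ofReal_mul (by positivity)]
          refine ENNReal.ofReal_le_ofReal ?_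
          have htn : (t : ℝ) ≤ n := by exact_mod_cast (Finset.mem_Icc.1 ht).2
          calc A * (2 / n) * (V * t) ≤ A * (2 / n) * (V * n) := by gcongr
            _ = A * (2 * V) := by field_simp
      _ = ENNReal.ofReal ((1 + 2 * M + 2 * V) * (n : ℝ) ^ (1 - α / 2)) := by
          rw [Finset.sum_const, Nat.card_Icc, Nat.add_sub_cancel, nsmul_eq_mul,
            ← ENNReal.ofReal_natCast, ← ENNReal.ofReal_mul (by positivity)]
          congr 1
          rw [show 1 - α / 2 = 1 + -α / 2 by ring, Real.rpow_add hn0, Real.rpow_one, ← hA]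
          ring

end PowerSums

/-! ### The three norming sequences -/

theorem sqrt_mul_rpow_sqrt {n : ℝ} (hn : 0 < n) (p : ℝ) :
    Real.sqrt n * Real.sqrt n ^ p = n ^ (1 / 2 + p / 2) := by
  rw [Real.sqrt_eq_rpow, ← Real.rpow_mul hn.le, ← Real.rpow_add hn]
  congr 1
  ring

theorem integral_rpow_neg_of_pos {α a b : ℝ} (hα : α ≠ 1) (ha : 0 < a) (hab : a ≤ b) :
    ∫ u in a..b, u ^ (-α) = (b ^ (1 - α) - a ^ (1 - α)) / (1 - α) := by
  rw [integral_rpow, show -α + 1 = 1 - α by ring]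
  refine Or.inr ⟨fun h => hα (by linarith), ?_⟩
  rw [Set.uIcc_of_le hab]
  exact fun h => absurd h.1 (not_le.2 ha)

/-- For `α > 1` the integral is governed by its lower limit `η / √n`. -/
theorem exists_truncation_bound_of_one_lt {α : ℝ} (hα : 1 < α) {M L η : ℝ} (hM : 0 < M)
    (hL : 0 < L) (hη : 0 < η) (hη1 : η ≤ 1) :
    ∃ C : ℝ, 0 < C ∧ ∀ᶠ n : ℕ in atTop, M + (n : ℝ) ^ (1 - α / 2) +
      L * (Real.sqrt n * ∫ u in (η / Real.sqrt n)..(Real.sqrt n), u ^ (-α)) ≤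
        C * (n : ℝ) ^ (α / 2) := by
  have hα' : 0 < α - 1 := by linarith
  refine ⟨M + 1 + L * (η ^ (1 - α) / (α - 1)), by positivity, ?_⟩
  filter_upwards [eventually_ge_atTop 1] with n hn
  have hn1 : (1 : ℝ) ≤ n := by exact_mod_cast hn
  have hn0 : (0 : ℝ) < n := by linarith
  have hs1 : 1 ≤ Real.sqrt n := by rw [Real.one_le_sqrt]; exact hn1
  have hab : η / Real.sqrt n ≤ Real.sqrt n := by
    rw [div_le_iff₀ (by positivity)]; nlinarith
  have h1 : 1 ≤ (n : ℝ) ^ (α / 2) := Real.one_le_rpow hn1 (by linarith)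
  have h2 : (n : ℝ) ^ (1 - α / 2) ≤ (n : ℝ) ^ (α / 2) :=
    Real.rpow_le_rpow_of_exponent_le hn1 (by linarith)
  have h3 : Real.sqrt n * ∫ u in (η / Real.sqrt n)..(Real.sqrt n), u ^ (-α) ≤
      η ^ (1 - α) / (α - 1) * (n : ℝ) ^ (α / 2) := by
    rw [integral_rpow_neg_of_pos hα.ne' (by positivity) hab]
    have h4 : (Real.sqrt n ^ (1 - α) - (η / Real.sqrt n) ^ (1 - α)) / (1 - α) ≤
        (η / Real.sqrt n) ^ (1 - α) / (α - 1) := by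
      rw [← neg_div_neg_eq, neg_sub, neg_sub]
      gcongr
      have : 0 < Real.sqrt n ^ (1 - α) := by positivity
      linarith
    refine (mul_le_mul_of_nonneg_left h4 (by positivity)).trans (le_of_eq ?_)
    rw [Real.div_rpow hη.le (by positivity), div_eq_mul_inv (η ^ (1 - α)),
      ← Real.rpow_neg (by positivity)]
    calc Real.sqrt n * (η ^ (1 - α) * Real.sqrt n ^ (-(1 - α)) / (α - 1))
        = η ^ (1 - α) / (α - 1) * (Real.sqrt n * Real.sqrt n ^ (-(1 - α))) := by ring
      _ = _ := by rw [sqrt_mul_rpow_sqrt hn0]; congr 2; ring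
  calc _ ≤ M * (n : ℝ) ^ (α / 2) + (n : ℝ) ^ (α / 2) +
        L * (η ^ (1 - α) / (α - 1) * (n : ℝ) ^ (α / 2)) := by
        gcongr
        nlinarith
    _ = _ := by ring

/-- For `α = 1` the integral is `log (n / η)`; taking `n ≥ 3` makes `log n ≥ 1`. -/
theorem exists_truncation_bound_of_eq_one {M L η : ℝ} (hM : 0 < M)
    (hL : 0 < L) (hη : 0 < η) (hη1 : η ≤ 1) :
    ∃ C : ℝ, 0 < C ∧ ∀ᶠ n : ℕ in atTop, M + (n : ℝ) ^ (1 - (1 : ℝ) / 2) +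
      L * (Real.sqrt n * ∫ u in (η / Real.sqrt n)..(Real.sqrt n), u ^ (-(1 : ℝ))) ≤
        C * ((n : ℝ) ^ (1 / 2 : ℝ) * Real.log n) := by
  have hlogη : 0 ≤ -Real.log η := neg_nonneg.2 (Real.log_nonpos hη.le hη1)
  have hlogη1 : 0 < 1 - Real.log η := by linarith
  refine ⟨M + 1 + L * (1 - Real.log η), by positivity, ?_⟩
  filter_upwards [eventually_ge_atTop 3] with n hn
  have hn3 : (3 : ℝ) ≤ n := by exact_mod_cast hn
  have hn1 : (1 : ℝ) ≤ n := by linarith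
  have hn0 : (0 : ℝ) < n := by linarith
  have hs1 : 1 ≤ Real.sqrt n := by rw [Real.one_le_sqrt]; exact hn1
  have hlog : 1 ≤ Real.log n := by
    rw [Real.le_log_iff_exp_le hn0]
    exact (Real.exp_one_lt_d9.le.trans (by norm_num)).trans hn3
  have h3 : ∫ u in (η / Real.sqrt n)..(Real.sqrt n), u ^ (-(1 : ℝ)) ≤
      (1 - Real.log η) * Real.log n := by
    simp only [Real.rpow_neg_one]
    rw [integral_inv_of_pos (by positivity) (by positivity), div_div_eq_mul_div,
      Real.mul_self_sqrt hn0.le, Real.log_div hn0.ne' hη.ne']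
    nlinarith
  rw [show (1 : ℝ) - 1 / 2 = 1 / 2 by norm_num, ← Real.sqrt_eq_rpow]
  have h4 : 1 ≤ Real.sqrt n * Real.log n := one_le_mul_of_one_le_of_one_le hs1 hlog
  calc _ ≤ M * (Real.sqrt n * Real.log n) + Real.sqrt n * Real.log n +
        L * (Real.sqrt n * ((1 - Real.log η) * Real.log n)) := by
        gcongr
        · nlinarith
        · nlinarith
    _ = _ := by ring

/-- For `α < 1` the integral is governed by its upper limit `√n`. -/
theorem exists_truncation_bound_of_lt_one {α : ℝ} (hα : α < 1) {M L η : ℝ} (hM : 0 < M)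
    (hL : 0 < L) (hη : 0 < η) (hη1 : η ≤ 1) :
    ∃ C : ℝ, 0 < C ∧ ∀ᶠ n : ℕ in atTop, M + (n : ℝ) ^ (1 - α / 2) +
      L * (Real.sqrt n * ∫ u in (η / Real.sqrt n)..(Real.sqrt n), u ^ (-α)) ≤
        C * (n : ℝ) ^ (1 - α / 2) := by
  have hα' : 0 < 1 - α := by linarith
  refine ⟨M + 1 + L * (1 / (1 - α)), by positivity, ?_⟩
  filter_upwards [eventually_ge_atTop 1] with n hn
  have hn1 : (1 : ℝ) ≤ n := by exact_mod_cast hn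
  have hn0 : (0 : ℝ) < n := by linarith
  have hs1 : 1 ≤ Real.sqrt n := by rw [Real.one_le_sqrt]; exact hn1
  have hab : η / Real.sqrt n ≤ Real.sqrt n := by
    rw [div_le_iff₀ (by positivity)]; nlinarith
  have h1 : 1 ≤ (n : ℝ) ^ (1 - α / 2) := Real.one_le_rpow hn1 (by linarith)
  have h3 : Real.sqrt n * ∫ u in (η / Real.sqrt n)..(Real.sqrt n), u ^ (-α) ≤
      1 / (1 - α) * (n : ℝ) ^ (1 - α / 2) := by
    rw [integral_rpow_neg_of_pos hα.ne (by positivity) hab]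
    have h4 : (Real.sqrt n ^ (1 - α) - (η / Real.sqrt n) ^ (1 - α)) / (1 - α) ≤
        Real.sqrt n ^ (1 - α) / (1 - α) := by
      gcongr
      have : 0 < (η / Real.sqrt n) ^ (1 - α) := by positivity
      linarith
    refine (mul_le_mul_of_nonneg_left h4 (by positivity)).trans (le_of_eq ?_)
    calc Real.sqrt n * (Real.sqrt n ^ (1 - α) / (1 - α))
        = 1 / (1 - α) * (Real.sqrt n * Real.sqrt n ^ (1 - α)) := by ring
      _ = _ := by rw [sqrt_mul_rpow_sqrt hn0]; congr 2; ring
  calc _ ≤ M * (n : ℝ) ^ (1 - α / 2) + (n : ℝ) ^ (1 - α / 2) +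
        L * (1 / (1 - α) * (n : ℝ) ^ (1 - α / 2)) := by
        gcongr
        nlinarith
    _ = _ := by ring

theorem theorem1 {Ω : Type*} [MeasurableSpace Ω] (μ : Measure Ω) [IsProbabilityMeasure μ]
    (ε : ℤ → Ω → ℝ) (φ : ℕ → ℝ) (x : ℕ → Ω → ℝ) (ν : ℝ) (α : ℝ)
    -- the innovations are i.i.d. with mean zero and finite variance
    (hε_meas : ∀ i, Measurable (ε i))
    (hε_indep : iIndepFun ε μ)
    (hε_ident : ∀ i, IdentDistrib (ε i) (ε 0) μ μ)
    (hε_var : MemLp (ε 0) 2 μ)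
    (hε_mean : ∫ ω, ε 0 ω ∂μ = 0)
    -- they have a Lebesgue density and their characteristic function lies in `L^ν`
    (hε_pdf : HasPDF (ε 0) μ volume)
    (hν : 1 ≤ ν)
    (hε_char : Integrable (fun s : ℝ => ‖charFun (μ.map (ε 0)) s‖ ^ ν) volume)
    -- the coefficients
    (hφ_summable : Summable (fun j => |φ j|))
    (hφ_sum : ∑' j, φ j ≠ 0)
    -- the integrated process
    (hx0_meas : Measurable (x 0))
    (hx0_indep : IndepFun (x 0) (fun ω (t : ℕ) => linearProcess φ ε ((t : ℤ) + 1) ω) μ)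
    (hx : ∀ (t : ℕ) (ω : Ω), x (t + 1) ω = x t ω + linearProcess φ ε ((t : ℤ) + 1) ω) :
    (1 < α →
      IsBigOInProbability μ (negPowerSum x α) (fun n : ℕ => (n : ℝ) ^ (α / 2))) ∧
    (α = 1 →
      IsBigOInProbability μ (negPowerSum x α)
        (fun n : ℕ => (n : ℝ) ^ (1 / 2 : ℝ) * Real.log (n : ℝ))) ∧
    (-2 ≤ α ∧ α < 1 →
      IsBigOInProbability μ (negPowerSum x α) (fun n : ℕ => (n : ℝ) ^ (1 - α / 2))) := by
  have hac : μ.map (ε 0) ≪ volume := HasPDF.absolutelyContinuous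
  have hν0 : 0 < ν := by linarith
  have hsum := ae_summable_linearProcess hε_meas hε_ident (hε_var.mono_exponent one_le_two)
    hφ_summable
  have hx_meas : ∀ t, Measurable (x t) := fun t => by
    have heq : x t = fun ω => x 0 ω + linearPartialSum φ ε t ω :=
      funext fun ω => eq_add_linearPartialSum hx t ω
    rw [heq]
    exact hx0_meas.add (measurable_linearPartialSum hε_meas t)
  have hxS := norm_charFun_le_charFun_linearPartialSum hε_meas hx0_meas hx0_indep hx
  obtain ⟨K, hK, t₀, hball⟩ := exists_measureReal_abs_le_le hε_meas hε_indep hε_ident hε_var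
    hε_mean hac hν0 hε_char hφ_summable hφ_sum hsum hx_meas hxS
  have hne : ∀ t, 1 ≤ t → ∀ᵐ ω ∂μ, x t ω ≠ 0 := fun t ht =>
    ae_ne_zero_of_one_le hε_meas hε_indep hε_ident hac hφ_sum hsum hx_meas hxS ht
  have hpow : ∀ p : ℝ, ∀ᶠ n : ℕ in atTop, (0 : ℝ) < (n : ℝ) ^ p := fun p => by
    filter_upwards [eventually_ge_atTop 1] with n hn
    have : (0 : ℝ) < n := by exact_mod_cast hn
    positivity
  refine ⟨fun hα => ?_, ?_, fun ⟨hα2, hα1⟩ => ?_⟩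
  · exact isBigOInProbability_negPowerSum_of_pos hx_meas hne hK hball (by linarith) (hpow _)
      fun M L η hM hL hη hη1 => exists_truncation_bound_of_one_lt hα hM hL hη hη1
  · rintro rfl
    refine isBigOInProbability_negPowerSum_of_pos hx_meas hne hK hball one_pos ?_
      fun M L η hM hL hη hη1 => exists_truncation_bound_of_eq_one hM hL hη hη1
    filter_upwards [hpow (1 / 2), eventually_ge_atTop 2] with n h1 h2
    exact mul_pos h1 (Real.log_pos (by exact_mod_cast h2))
  · rcases lt_or_ge 0 α with hα0 | hα0
    · exact isBigOInProbability_negPowerSum_of_pos hx_meas hne hK hball hα0 (hpow _)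
        fun M L η hM hL hη hη1 => exists_truncation_bound_of_lt_one hα1 hM hL hη hη1
    · refine isBigOInProbability_negPowerSum_of_nonpos hx_meas
        (V := (∑' j, |φ j|) ^ 2 * variance (ε 0) μ)
        (mul_nonneg (sq_nonneg _) (variance_nonneg _ _)) (fun t => ?_) hα2 hα0
      simp only [fun ω => eq_add_linearPartialSum hx t ω, add_sub_cancel_left]
      exact lintegral_sq_linearPartialSum_le hε_meas hε_indep hε_ident hε_var hε_mean
        hφ_summable hsum t
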